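/- Let $n\ge 1$, and let $A\subset\mathbb Z^{n}\oplus\mathbb Z^2$ be a finite set of full dimension $n+2$ with $0\in A$, such that the image under $\mathbb Z^n\oplus\mathbb Z^2\to\mathbb Z^n$ of the sublattice generated by $A$ is all of $\mathbb Z^n$. Let $(x_1,\dots,x_n,y,t)$ be the corresponding coordinates on $(\mathbb C\setminus 0)^{n+2}$, let $\pi(x,y,t)=(y,t)$, and suppose that $\Delta=\operatorname{conv}(A)$ lies in the half-space where the last coordinate is $\ge 0$ and meets the hyperplane where it is $0$ in a facet $\tilde\Gamma$ of $\Delta$. Write a tuple $f_1,\dots,f_{n+1}$ of Laurent polynomials supported at $A$ as $f_i=\sum_{m\ge 0}t^m\tilde g_{i,m}(x,y)$, so that $\tilde g_{i,0}=f_i^{\tilde\Gamma}$, and let $\tilde{\mathcal C}=\{f_1=\dots=f_{n+1}=0\}\subset(\mathbb C\setminus 0)^{n+2}$. Then for generic $f_1,\dots,f_{n+1}\in\mathbb C^A$ (that is, for all tuples in some nonempty Zariski open set) the following holds. Let $p_1\ne p_2$ be points with $\pi(p_1)=\pi(p_2)=p$ that lie on the orbit $\{t=0\}\subset(\mathbb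 C\setminus 0)^{n+1}\times\mathbb C$ of $\tilde\Gamma$ and in the closure of $\tilde{\mathcal C}$. Then there is an integer $K=K(p_1,p_2)\ge 1$ such that for all $1\le i\le n+1$ one has $\tilde g_{i,m}(p_1)=\tilde g_{i,m}(p_2)$ for every $m<K$, and $\tilde g_{i,K}(p_1)\ne\tilde g_{i,K}(p_2)$. The closure of $\tilde{\mathcal C}$ has a branch through $p_1$ and a branch through $p_2$; injective local parametrizations of such branches stay injective near the base point after composition with $\pi$; and the order of contact (the local intersection number) at $p$ of the projection under $\pi$ of any branch through $p_1$ with that of any branch through $p_2$ is equal to $K(p_1,p_2)$. -/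

import Mathlib

open Filter Topology

noncomputable section

namespace PlaneProjection

/-- The character lattice `ℤⁿ ⊕ ℤ ⊕ ℤ` of the torus with coordinates `(x₁, …, xₙ, y, t)`. -/
abbrev Exponent (n : ℕ) : Type := (Fin n → ℤ) × ℤ × ℤ

/-- The affine space with coordinates `(x₁, …, xₙ, y, t)`. -/
abbrev Point (n : ℕ) : Type := (Fin n → ℂ) × ℂ × ℂ

/-- A lattice point seen in `ℝⁿ ⊕ ℝ ⊕ ℝ`. -/
def toRealPoint {n : ℕ} (α : Exponent n) : (Fin n → ℝ) × ℝ × ℝ :=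
  (fun j => (α.1 j : ℝ), (α.2.1 : ℝ), (α.2.2 : ℝ))

/-- `A` has maximal dimension. -/
def IsFullDimensional {n : ℕ} (A : Finset (Exponent n)) : Prop :=
  affineSpan ℝ (toRealPoint '' (A : Set (Exponent n))) = ⊤

/-- The polytope `Δ`, the convex hull of `A`. -/
def polytope {n : ℕ} (A : Finset (Exponent n)) : Set ((Fin n → ℝ) × ℝ × ℝ) :=
  convexHull ℝ (toRealPoint '' (A : Set (Exponent n)))

/-- `Δ` lies in the half-space `t ≥ 0` and meets the hyperplane `t = 0` in a facet,
that is, in a face of dimension `n + 1`. -/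
def HasVerticalFacet {n : ℕ} (A : Finset (Exponent n)) : Prop :=
  (∀ v ∈ polytope A, 0 ≤ v.2.2) ∧
    Module.finrank ℝ (vectorSpan ℝ {v | v ∈ polytope A ∧ v.2.2 = 0}) = n + 1

/-- The vertical index of `A`: the index in `ℤⁿ = ℤⁿ⁺² / ⟨eₙ₊₁, eₙ₊₂⟩` of the image of the
sublattice generated by `A` (with value `0` if that index is infinite). -/
def verticalIndex {n : ℕ} (A : Finset (Exponent n)) : ℕ :=
  ((AddSubgroup.closure (A : Set (Exponent n))).map
    (AddMonoidHom.fst (Fin n → ℤ) (ℤ × ℤ))).index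

/-- A tuple `f₁, …, fₙ₊₁ ∈ ℂ^A`, given by its coefficients. -/
abbrev Tuple {n : ℕ} (A : Finset (Exponent n)) : Type := Fin (n + 1) → A → ℂ

/-- A property holds for generic tuples if it holds on a nonempty Zariski open set of tuples
(equivalently, on the complement of the zero locus of some nonzero polynomial). -/
def Generic {n : ℕ} (A : Finset (Exponent n)) (P : Tuple A → Prop) : Prop :=
  ∃ H : MvPolynomial (Fin (n + 1) × A) ℂ, H ≠ 0 ∧
    ∀ c : Tuple A, MvPolynomial.eval (fun q => c q.1 q.2) H ≠ 0 → P c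

variable {n : ℕ} {A : Finset (Exponent n)}

/-- The value of the Laurent polynomial `fᵢ` at a point of the torus. -/
def evalPoly (c : Tuple A) (i : Fin (n + 1)) (z : Point n) : ℂ :=
  ∑ α : A, c i α * ((∏ j, z.1 j ^ α.1.1 j) * z.2.1 ^ α.1.2.1 * z.2.2 ^ α.1.2.2)

/-- The coefficient `g̃ᵢ,ₘ(x, y)` of `tᵐ` in `fᵢ`; for `m = 0` it is the truncation `gᵢ` of `fᵢ`
to the facet in `t = 0`. It does not depend on the coordinate `t` of the point. -/
def slice (c : Tuple A) (i : Fin (n + 1)) (m : ℕ) (z : Point n) : ℂ :=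
  ∑ α : A with α.1.2.2 = (m : ℤ), c i α * ((∏ j, z.1 j ^ α.1.1 j) * z.2.1 ^ α.1.2.1)

/-- The complete intersection `f₁ = … = fₙ₊₁ = 0` in the torus `(ℂ ∖ 0)ⁿ⁺²`. -/
def curve (c : Tuple A) : Set (Point n) :=
  {z | (∀ j, z.1 j ≠ 0) ∧ z.2.1 ≠ 0 ∧ z.2.2 ≠ 0 ∧ ∀ i, evalPoly c i z = 0}

/-- The limit points of the curve on the orbit of the facet in `t = 0`. The torus together with
this orbit is the open subset `(ℂ ∖ 0)ⁿ⁺¹ × ℂ` of the toric variety of `Δ`, and the orbit is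
given there by `t = 0`. -/
def limitPoints (c : Tuple A) : Set (Point n) :=
  {p | (∀ j, p.1 j ≠ 0) ∧ p.2.1 ≠ 0 ∧ p.2.2 = 0 ∧ p ∈ closure (curve c)}

/-- The projection forgetting the first `n` coordinates. -/
def proj (z : Point n) : ℂ × ℂ := z.2

/-- `K` is the first level at which the slices distinguish `p₁` and `p₂`: all slices of lower
level take equal values at the two points, and those of level `K` take different values. -/
def IsSeparationLevel (c : Tuple A) (p₁ p₂ : Point n) (K : ℕ) : Prop :=
  (∀ m < K, ∀ i, slice c i m p₁ = slice c i m p₂) ∧ ∀ i, slice c i K p₁ ≠ slice c i K p₂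

/-- `γ` is an injective germ of holomorphic arc centred at `p`, that is, a primitive
parametrization of an irreducible germ of analytic curve. -/
def IsPrimitiveArc {E : Type*} [NormedAddCommGroup E] [NormedSpace ℂ E]
    (γ : ℂ → E) (p : E) : Prop :=
  AnalyticAt ℂ γ 0 ∧ γ 0 = p ∧ ∃ U ∈ 𝓝 (0 : ℂ), Set.InjOn γ U

/-- `γ` parametrizes a branch at `p` of the closure of the curve. -/
def IsBranchAt (c : Tuple A) (p : Point n) (γ : ℂ → Point n) : Prop :=
  IsPrimitiveArc γ p ∧ ∀ᶠ s in 𝓝[≠] (0 : ℂ), γ s ∈ curve c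

/-- The order of contact (local intersection number) of two plane branches with primitive
parametrizations `φ` and `ψ`. It is the order of vanishing along `ψ` of a generator of the ideal of
germs of holomorphic functions vanishing on the branch `φ`; as this ideal is principal, that is the
least order of vanishing along `ψ` of an element of the ideal. It is `1` for
transverse smooth branches and `⊤` for equal ones. -/
def contactOrder (φ ψ : ℂ → ℂ × ℂ) : ℕ∞ :=
  ⨅ (h : ℂ × ℂ → ℂ) (_ : AnalyticAt ℂ h (φ 0)) (_ : ∀ᶠ s in 𝓝 (0 : ℂ), h (φ s) = 0),
    analyticOrderAt (fun s => h (ψ s)) 0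

end PlaneProjection

end

/-!
Write `z = (x, y)`, so that the slices of level `0` are `n + 1` Laurent polynomials in the `n + 1`
coordinates `z`. The proof has a generic part and a local analytic part.

**Generic part.** A tuple is nondegenerate (`IsNondegenerate`) if the zeros of its slices of level
`0` in the torus are simple; if two such zeros with the same `y` always differ by an element `u` of
the torus `(ℂ ∖ 0)ⁿ` on which all exponents of the facet are trivial; and if, for every such `u` and
the relevant levels `K`, the differences `dᵢ` of the slices of level `K` at a zero and at its
translate are nonzero and form a vector outside the span of the `x`-derivatives of the slices of
level `0`. As the facet has dimension `n + 1`, there are finitely many such `u`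
(`finite_setOf_forall_facet_prod_zpow_eq_one`), so only finitely many conditions are involved. Each
of them fails only for tuples satisfying more independent linear equations than these equations have
parameters. By Cramer's rule such tuples form finitely many images of polynomial maps from spaces of
smaller dimension, and such an image lies in a hypersurface, because a polynomial ring in `N`
variables has transcendence degree `N` (`exists_ne_zero_eval_eq_zero_of_linear_conditions`).

**Local part.** Let `p₁ ≠ p₂` be limit points with the same projection, let `u` be the quotient of
their `x`-coordinates, and let `K` be the lowest level of an exponent that is nontrivial on `u`. It
exists because `A` generates a lattice projecting onto `ℤⁿ`, and it is positive because the points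
agree on the facet. At a simple zero the functions `f₁, …, fₙ₊₁, t` are local coordinates
(`exists_local_inverse`), so the curve has exactly one branch at `pᵢ`, parametrized by `t`, and its
projection is a graph `y = yᵢ(t)`. An injective germ has nonzero derivative
(`deriv_ne_zero_of_injOn`), so every other primitive parametrization is obtained by a local change
of the coordinate `t`, and the order of contact is the order of vanishing of `y₂ - y₁`
(`contactOrder_eq_analyticOrderAt_sub`). Translation by `u⁻¹` carries the second branch to `p₁`
without changing `y`. It preserves the terms of `fᵢ` of level below `K`, so `fᵢ` takes the value
`t ^ K * (dᵢ + o(1))` on the translate, and the inverse of the coordinates gives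
`y₂ - y₁ = t ^ K * (a + o(1))`, where `a` is the `y`-component of the preimage of `d` under the
Jacobian matrix. Transversality says that `a ≠ 0` (`IsLocalInverse.analyticOrderAt_sub_eq`).
-/

open Filter Topology

noncomputable section

namespace PlaneProjection

/-! ### Elimination of parameters -/

open MvPolynomial in
/-- The image of a polynomial map from a space of smaller dimension lies in a hypersurface. -/
theorem exists_ne_zero_eval_comp_eq_zero {σ τ : Type} [Fintype σ] [Fintype τ]
    (hcard : Fintype.card σ < Fintype.card τ) (P : τ → MvPolynomial σ ℂ) :
    ∃ H : MvPolynomial τ ℂ, H ≠ 0 ∧ ∀ s : σ → ℂ, eval (fun t => eval s (P t)) H = 0 := by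
  have hdep : ¬ AlgebraicIndependent ℂ P := by
    intro h
    have := h.cardinalMk_le_trdeg
    rw [MvPolynomial.trdeg_of_isDomain] at this
    simp at this
    omega
  rw [algebraicIndependent_iff] at hdep
  push Not at hdep
  obtain ⟨H, hH, hne⟩ := hdep
  refine ⟨H, hne, fun s => ?_⟩
  have := congrArg (eval s) hH
  rw [map_zero] at this
  rw [← this, aeval_def, eval₂_eq', eval_eq']
  simp [MvPolynomial.algebraMap_eq]

/-- A matrix with independent rows has an invertible minor of full size. -/
theorem exists_embedding_det_ne_zero {κ τ : Type} [Fintype κ] [DecidableEq κ] [Fintype τ]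
    (M : Matrix κ τ ℂ) (hM : LinearIndependent ℂ M.row) :
    ∃ e : κ ↪ τ, (M.submatrix id e).det ≠ 0 := by
  obtain ⟨κ', a, hinj, hspan, hli⟩ := exists_linearIndependent' ℂ M.col
  have hrank : Module.finrank ℂ (Submodule.span ℂ (Set.range M.col)) = Fintype.card κ := by
    rw [← Matrix.rank_eq_finrank_span_cols]
    exact hM.rank_matrix
  have : Fintype κ' := Fintype.ofInjective a hinj
  have hcard : Fintype.card κ = Fintype.card κ' := by
    rw [← hrank, ← hspan]
    exact finrank_span_eq_card hli
  let e := Fintype.equivOfCardEq hcard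
  refine ⟨⟨a ∘ e, hinj.comp e.injective⟩, ?_⟩
  have : LinearIndependent ℂ (M.submatrix id (a ∘ e)).col := by
    have := hli.comp e e.injective
    exact this
  have := Matrix.linearIndependent_cols_iff_isUnit.1 this
  rw [Matrix.isUnit_iff_isUnit_det] at this
  exact this.ne_zero

open MvPolynomial in
/-- Vectors annihilated by more independent linear forms than the forms have parameters lie in a
hypersurface. At parameters where a given maximal minor of the forms does not vanish, their common
kernel is parametrized polynomially by Cramer's rule. -/
theorem exists_ne_zero_eval_eq_zero_of_linear_conditions {σ τ κ : Type} [Fintype σ] [Fintype τ]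
    [Fintype κ] (hcard : Fintype.card σ < Fintype.card κ) (W : κ → τ → MvPolynomial σ ℂ) :
    ∃ H : MvPolynomial τ ℂ, H ≠ 0 ∧ ∀ (s : σ → ℂ) (c : τ → ℂ),
      LinearIndependent ℂ (fun k t => eval s (W k t)) →
      (∀ k, ∑ t, eval s (W k t) * c t = 0) → eval c H = 0 := by
  classical
  have key : ∀ e : κ ↪ τ, ∃ H : MvPolynomial τ ℂ, H ≠ 0 ∧ ∀ (s : σ → ℂ) (c : τ → ℂ),
      (Matrix.of fun k k' => eval s (W k (e k'))).det ≠ 0 →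
      (∀ k, ∑ t, eval s (W k t) * c t = 0) → eval c H = 0 := by
    intro e
    let R := {t // t ∉ Set.range e}
    let M : Matrix κ κ (MvPolynomial σ ℂ) := Matrix.of fun k k' => W k (e k')
    let P : τ → MvPolynomial (σ ⊕ R) ℂ := fun t =>
      if h : t ∈ Set.range e then
        - ∑ r : R, rename Sum.inl (∑ k, M.adjugate h.choose k * W k r) * X (Sum.inr r)
      else rename Sum.inl M.det * X (Sum.inr ⟨t, h⟩)
    have hc : Fintype.card (σ ⊕ R) < Fintype.card τ := by
      have h1 : Fintype.card R = Fintype.card τ - Fintype.card κ := by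
        have h2 := Fintype.card_subtype_compl (fun t => t ∈ Set.range e)
        have h3 : Fintype.card {t // t ∈ Set.range e} = Fintype.card κ :=
          Set.card_range_of_injective e.injective
        rw [h3] at h2
        exact h2
      have := Fintype.card_le_of_embedding e
      rw [Fintype.card_sum]
      omega
    obtain ⟨H, hne, hH⟩ := exists_ne_zero_eval_comp_eq_zero hc P
    refine ⟨H, hne, fun s c hdet hker => ?_⟩
    set D := (Matrix.of fun k k' => eval s (W k (e k'))).det with hD
    have hMD : eval s M.det = D := by
      rw [RingHom.map_det]; rfl
    have hMA : ∀ k k', eval s (M.adjugate k k') =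
        (Matrix.of fun k k' => eval s (W k (e k'))).adjugate k k' := by
      intro k k'
      have := congrFun (congrFun (RingHom.map_adjugate (eval s) M) k) k'
      exact this
    let v : σ ⊕ R → ℂ := Sum.elim s (fun r => c r / D)
    have hv : v ∘ Sum.inl = s := rfl
    have hc : (fun t => eval v (P t)) = c := by
      funext t
      by_cases h : t ∈ Set.range e
      · have hP : P t = - ∑ r : R, rename Sum.inl (∑ k, M.adjugate h.choose k * W k r) *
            X (Sum.inr r) := dif_pos h
        have he : e h.choose = t := h.choose_spec
        rw [hP]
        simp only [map_neg, map_sum, map_mul, eval_rename, hv, eval_X, hMA]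
        -- the linear system for the pivot coordinates
        have hsys : (Matrix.of fun k k' => eval s (W k (e k'))).mulVec (fun k' => c (e k')) =
            fun k => - ∑ r : R, eval s (W k r) * c r := by
          funext k
          have h1 := hker k
          rw [← Fintype.sum_subtype_add_sum_subtype (fun t => t ∈ Set.range e)] at h1
          have h2 : ∑ i : {t // t ∈ Set.range e}, eval s (W k i) * c i =
              ∑ k', eval s (W k (e k')) * c (e k') :=
            ((Equiv.ofInjective e e.injective).sum_comp
              (fun i : Set.range e => eval s (W k i) * c i)).symm
          refine eq_neg_of_add_eq_zero_left (Eq.trans (congrArg₂ _ h2.symm rfl) ?_)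
          convert h1
        have h3 := congrArg
          ((Matrix.of fun k k' => eval s (W k (e k'))).adjugate.mulVec) hsys
        rw [Matrix.mulVec_mulVec, Matrix.adjugate_mul, Matrix.smul_mulVec,
          Matrix.one_mulVec] at h3
        have h4 := congrFun h3 h.choose
        simp only [Pi.smul_apply, he, smul_eq_mul, Matrix.mulVec, dotProduct] at h4
        rw [← hD] at h4
        have h5 : c t = (D * c t) / D := by field_simp
        rw [h5, h4, Finset.sum_div]
        simp only [v, Sum.elim_inr, Finset.sum_mul, mul_neg, Finset.mul_sum, neg_div,
          Finset.sum_div, Finset.sum_neg_distrib]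
        rw [Finset.sum_comm]
        refine congrArg _ (Finset.sum_congr rfl fun k _ => Finset.sum_congr rfl fun r _ => ?_)
        ring
      · have hP : P t = rename Sum.inl M.det * X (Sum.inr ⟨t, h⟩) := dif_neg h
        rw [hP]
        simp only [map_mul, eval_rename, hv, eval_X, hMD, v, Sum.elim_inr]
        field_simp
    rw [← hH v, hc]
  choose H hne hH using key
  refine ⟨∏ e, H e, Finset.prod_ne_zero_iff.2 fun e _ => hne e, fun s c hli hker => ?_⟩
  obtain ⟨e, he⟩ := exists_embedding_det_ne_zero (Matrix.of fun k t => eval s (W k t)) hli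
  rw [map_prod]
  exact Finset.prod_eq_zero (Finset.mem_univ e) (hH e s c he hker)

/-- The Laurent monomials of a finite family become polynomials after multiplication by a common
monomial. -/
theorem exists_polynomial_eq_monomial_mul {T ι : Type} [Fintype T] [Fintype ι] (e : T → ι → ℤ) :
    ∃ (P : T → MvPolynomial ι ℂ) (Q : (ι → ℂ) → ℂ), ∀ z : ι → ℂ, (∀ i, z i ≠ 0) →
      Q z ≠ 0 ∧ ∀ α, MvPolynomial.eval z (P α) = Q z * ∏ i, z i ^ e α i := by
  classical
  let N : ι → ℕ := fun i => ∑ α, (e α i).natAbs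
  refine ⟨fun α => ∏ i, MvPolynomial.X i ^ ((N i : ℤ) + e α i).toNat,
    fun z => ∏ i, z i ^ N i, fun z hz => ⟨Finset.prod_ne_zero_iff.2 fun i _ => pow_ne_zero _ (hz i),
      fun α => ?_⟩⟩
  rw [← Finset.prod_mul_distrib, map_prod]
  refine Finset.prod_congr rfl fun i _ => ?_
  rw [map_pow, MvPolynomial.eval_X, ← zpow_natCast, ← zpow_natCast, ← zpow_add₀ (hz i)]
  congr 1
  have : (e α i).natAbs ≤ N i :=
    Finset.single_le_sum (f := fun α => (e α i).natAbs) (fun _ _ => Nat.zero_le _)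
      (Finset.mem_univ α)
  omega

/-- For a tuple `c` and a point `z` of the torus, consider the coefficient vectors with entries
`c i α z^α`, one for each `i`. The tuples for which a linear form `L₀` vanishes on all these
vectors, and further forms `Lⱼ` vanish on some combination of them with coefficients `l i`, lie in a
hypersurface, provided that `L₀` and the `Lⱼ` are independent and that `z` and `l` together
depend on fewer parameters than there are conditions. -/
theorem exists_ne_zero_eval_eq_zero_of_combination {T ι I J ρ : Type} [Fintype T] [Fintype ι]
    [Fintype I] [Fintype J] [Fintype ρ] (e : T → ι → ℤ) (l : I → MvPolynomial ρ ℂ)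
    (hcard : Fintype.card ι + Fintype.card ρ < Fintype.card I + Fintype.card J)
    (L₀ : T → ℂ) (L : J → T → ℂ)
    (hL : ∀ (a₀ : ℂ) (a : J → ℂ), (∀ α, a₀ * L₀ α + ∑ j, a j * L j α = 0) → a₀ = 0 ∧ a = 0) :
    ∃ H : MvPolynomial (I × T) ℂ, H ≠ 0 ∧ ∀ (c : I × T → ℂ) (z : ι → ℂ) (s : ρ → ℂ),
      (∀ i, z i ≠ 0) → (∃ i, MvPolynomial.eval s (l i) ≠ 0) →
      (∀ i, ∑ α, c (i, α) * L₀ α * ∏ k, z k ^ e α k = 0) →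
      (∀ j, ∑ i, MvPolynomial.eval s (l i) * ∑ α, c (i, α) * L j α * ∏ k, z k ^ e α k = 0) →
      MvPolynomial.eval c H = 0 := by
  classical
  obtain ⟨P, Q, hPQ⟩ := exists_polynomial_eq_monomial_mul e
  let W : I ⊕ J → I × T → MvPolynomial (ι ⊕ ρ) ℂ := Sum.elim
    (fun i q => if i = q.1 then .C (L₀ q.2) * .rename Sum.inl (P q.2) else 0)
    (fun j q => .rename Sum.inr (l q.1) * (.C (L j q.2) * .rename Sum.inl (P q.2)))
  obtain ⟨H, hne, hH⟩ := exists_ne_zero_eval_eq_zero_of_linear_conditions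
    (by simpa [Fintype.card_sum] using hcard) W
  refine ⟨H, hne, fun c z s hz hl h₀ hJ => ?_⟩
  obtain ⟨hQ, hP⟩ := hPQ z hz
  have hm : ∀ α, Q z * ∏ i, z i ^ e α i ≠ 0 := fun α =>
    mul_ne_zero hQ (Finset.prod_ne_zero_iff.2 fun i _ => zpow_ne_zero _ (hz i))
  let v : ι ⊕ ρ → ℂ := Sum.elim z s
  have hW₁ : ∀ i q, MvPolynomial.eval v (W (Sum.inl i) q) =
      if i = q.1 then L₀ q.2 * (Q z * ∏ k, z k ^ e q.2 k) else 0 := by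
    intro i q
    have hv : v ∘ Sum.inl = z := rfl
    simp only [W, Sum.elim_inl]
    split_ifs <;> simp [MvPolynomial.eval_rename, hv, hP]
  have hW₂ : ∀ j q, MvPolynomial.eval v (W (Sum.inr j) q) =
      MvPolynomial.eval s (l q.1) * (L j q.2 * (Q z * ∏ k, z k ^ e q.2 k)) := by
    intro j q
    have hv : v ∘ Sum.inl = z := rfl
    have hv' : v ∘ Sum.inr = s := rfl
    simp [W, MvPolynomial.eval_rename, hv, hv', hP]
  refine hH v c ?_ ?_
  · rw [Fintype.linearIndependent_iff]
    intro g hg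
    have h1 : ∀ i α, g (Sum.inl i) * L₀ α +
        ∑ j, (g (Sum.inr j) * MvPolynomial.eval s (l i)) * L j α = 0 := by
      intro i α
      have h2 := congrFun hg (i, α)
      simp only [Finset.sum_apply, Pi.smul_apply, smul_eq_mul, Fintype.sum_sum_type, hW₁, hW₂,
        mul_ite, mul_zero, Finset.sum_ite_eq', Finset.mem_univ, if_true, Pi.zero_apply] at h2
      refine (mul_eq_zero.1 (?_ : (Q z * ∏ i, z i ^ e α i) * _ = 0)).resolve_left (hm α)
      rw [← h2, mul_add, Finset.mul_sum]
      congr 1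
      · ring
      · exact Finset.sum_congr rfl fun j _ => by ring
    have h2 := fun i => hL _ _ (h1 i)
    obtain ⟨i₀, hi₀⟩ := hl
    rintro (i | j)
    · exact (h2 i).1
    · exact (mul_eq_zero.1 (congrFun (h2 i₀).2 j)).resolve_right hi₀
  · rintro (i | j)
    · simp only [hW₁, Fintype.sum_prod_type, ite_mul, zero_mul]
      rw [Finset.sum_eq_single i (fun b _ hb => by simp [hb.symm]) (by simp)]
      simp only [if_true]
      rw [← mul_zero (Q z), ← h₀ i, Finset.mul_sum]
      exact Finset.sum_congr rfl fun α _ => by ring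
    · simp only [hW₂, Fintype.sum_prod_type]
      rw [← mul_zero (Q z), ← hJ j, Finset.mul_sum]
      refine Finset.sum_congr rfl fun i _ => ?_
      rw [Finset.mul_sum, Finset.mul_sum]
      exact Finset.sum_congr rfl fun α _ => by ring

/-- Outside a hypersurface of tuples, the square matrix of the values of independent forms `Lⱼ` is
invertible at every point of the torus where the form `L₀` vanishes on the tuple. The parameters of
the eliminated family are the point and a row relation, normalized by one coordinate being `1`. -/
theorem exists_ne_zero_forall_kernel_eq_zero {T ι I J : Type} [Fintype T] [Fintype ι]
    [Fintype I] [Fintype J] (e : T → ι → ℤ) (hI : Fintype.card ι = Fintype.card I)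
    (hJ : Fintype.card J = Fintype.card I) (L₀ : T → ℂ) (L : J → T → ℂ)
    (hL : ∀ (a₀ : ℂ) (a : J → ℂ), (∀ α, a₀ * L₀ α + ∑ j, a j * L j α = 0) → a₀ = 0 ∧ a = 0) :
    ∃ H : MvPolynomial (I × T) ℂ, H ≠ 0 ∧ ∀ (c : I × T → ℂ) (z : ι → ℂ),
      MvPolynomial.eval c H ≠ 0 → (∀ i, z i ≠ 0) →
      (∀ i, ∑ α, c (i, α) * L₀ α * ∏ k, z k ^ e α k = 0) →
      ∀ ξ : J → ℂ, (∀ i, ∑ j, ξ j * ∑ α, c (i, α) * L j α * ∏ k, z k ^ e α k = 0) → ξ = 0 := by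
  classical
  have key : ∀ k : I, ∃ H : MvPolynomial (I × T) ℂ, H ≠ 0 ∧
      ∀ (c : I × T → ℂ) (z : ι → ℂ) (s : I → ℂ), s k = 1 → (∀ i, z i ≠ 0) →
      (∀ i, ∑ α, c (i, α) * L₀ α * ∏ k, z k ^ e α k = 0) →
      (∀ j, ∑ i, s i * ∑ α, c (i, α) * L j α * ∏ k, z k ^ e α k = 0) →
      MvPolynomial.eval c H = 0 := by
    intro k
    have hlt : Fintype.card {i // i ≠ k} < Fintype.card I :=
      Fintype.card_subtype_lt (x := k) (by simp)
    obtain ⟨H, hne, hH⟩ := exists_ne_zero_eval_eq_zero_of_combination (I := I)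
      (ρ := {i // i ≠ k}) e (fun i => if h : i = k then 1 else .X ⟨i, h⟩)
      (by omega) L₀ L hL
    refine ⟨H, hne, fun c z s hs hz h₀ h₁ => ?_⟩
    have hs' : ∀ i, MvPolynomial.eval (fun i : {i // i ≠ k} => s i)
        (if h : i = k then 1 else .X ⟨i, h⟩) = s i := by
      intro i
      split_ifs with h
      · simp [h, hs]
      · simp
    refine hH c z (fun i => s i) hz ⟨k, by rw [hs', hs]; exact one_ne_zero⟩ h₀ fun j => ?_
    simp only [hs']
    exact h₁ j
  choose H hne hH using key
  refine ⟨∏ k, H k, Finset.prod_ne_zero_iff.2 fun k _ => hne k, fun c z hc hz h₀ ξ hξ => ?_⟩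
  by_contra hξ0
  let eq := Fintype.equivOfCardEq hJ
  let M : Matrix I I ℂ := fun i i' => ∑ α, c (i, α) * L (eq.symm i') α * ∏ k, z k ^ e α k
  have hdet : M.det = 0 := by
    refine Matrix.exists_mulVec_eq_zero_iff.1 ⟨ξ ∘ eq.symm, fun h => hξ0 ?_, ?_⟩
    · funext j
      simpa using congrFun h (eq j)
    · funext i
      rw [Pi.zero_apply, ← hξ i, ← eq.symm.sum_comp]
      exact Finset.sum_congr rfl fun j _ => mul_comm _ _
  obtain ⟨s, hs, hsM⟩ := Matrix.exists_vecMul_eq_zero_iff.2 hdet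
  obtain ⟨k, hk⟩ := Function.ne_iff.1 hs
  refine hc ?_
  rw [map_prod]
  refine Finset.prod_eq_zero (Finset.mem_univ k)
    (hH k c z (fun i => s i / s k) (div_self hk) hz h₀ fun j => ?_)
  have := congrFun hsM (eq j)
  simp only [Matrix.vecMul, dotProduct, M, Equiv.symm_apply_apply, Pi.zero_apply] at this
  simp only [div_mul_eq_mul_div, ← Finset.sum_div, this, zero_div]

/-- Tuples that vanish at two points of the torus at which the monomials indexed by `S` take
non-proportional values lie in a hypersurface, provided that the pair of points depends on fewer
parameters than there are conditions. -/
theorem exists_ne_zero_eval_eq_zero_of_two_points {T ι I : Type} [Fintype T] [Fintype ι]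
    [Fintype I] (e₁ e₂ : T → ι → ℤ) (hcard : Fintype.card ι < 2 * Fintype.card I)
    (S : Finset T) :
    ∃ H : MvPolynomial (I × T) ℂ, H ≠ 0 ∧ ∀ (c : I × T → ℂ) (z : ι → ℂ), (∀ i, z i ≠ 0) →
      (∃ α ∈ S, ∃ β ∈ S, (∏ k, z k ^ e₁ α k) * (∏ k, z k ^ e₂ β k) ≠
        (∏ k, z k ^ e₁ β k) * (∏ k, z k ^ e₂ α k)) →
      (∀ i, ∑ α ∈ S, c (i, α) * ∏ k, z k ^ e₁ α k = 0) →
      (∀ i, ∑ α ∈ S, c (i, α) * ∏ k, z k ^ e₂ α k = 0) →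
      MvPolynomial.eval c H = 0 := by
  classical
  obtain ⟨P₁, Q₁, hPQ₁⟩ := exists_polynomial_eq_monomial_mul e₁
  obtain ⟨P₂, Q₂, hPQ₂⟩ := exists_polynomial_eq_monomial_mul e₂
  let W : I ⊕ I → I × T → MvPolynomial ι ℂ := Sum.elim
    (fun i q => if i = q.1 then (if q.2 ∈ S then P₁ q.2 else 0) else 0)
    (fun i q => if i = q.1 then (if q.2 ∈ S then P₂ q.2 else 0) else 0)
  obtain ⟨H, hne, hH⟩ := exists_ne_zero_eval_eq_zero_of_linear_conditions
    (by rw [Fintype.card_sum]; omega) W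
  refine ⟨H, hne, fun c z hz hind h₁ h₂ => ?_⟩
  obtain ⟨hQ₁, hP₁⟩ := hPQ₁ z hz
  obtain ⟨hQ₂, hP₂⟩ := hPQ₂ z hz
  have hker : ∀ (P : T → MvPolynomial ι ℂ) (e : T → ι → ℤ) (Q : ℂ),
      (∀ α, MvPolynomial.eval z (P α) = Q * ∏ k, z k ^ e α k) →
      (∀ i, ∑ α ∈ S, c (i, α) * ∏ k, z k ^ e α k = 0) → ∀ i,
      ∑ q : I × T, MvPolynomial.eval z
        (if i = q.1 then (if q.2 ∈ S then P q.2 else 0) else 0) * c q = 0 := by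
    intro P e Q hP h i
    rw [Fintype.sum_prod_type, Finset.sum_eq_single i (fun b _ hb => by simp [hb.symm]) (by simp)]
    simp only [if_true, apply_ite (MvPolynomial.eval z), map_zero, ite_mul, zero_mul]
    rw [← Finset.sum_filter, Finset.filter_mem_eq_inter, Finset.univ_inter, ← mul_zero Q, ← h i,
      Finset.mul_sum]
    exact Finset.sum_congr rfl fun α _ => by rw [hP]; ring
  refine hH z c ?_ ?_
  · rw [Fintype.linearIndependent_iff]
    intro g hg
    have h3 : ∀ i, ∀ α ∈ S, (g (Sum.inl i) * Q₁ z) * (∏ k, z k ^ e₁ α k) +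
        (g (Sum.inr i) * Q₂ z) * (∏ k, z k ^ e₂ α k) = 0 := by
      intro i α hα
      have h4 := congrFun hg (i, α)
      simp only [W, Finset.sum_apply, Pi.smul_apply, smul_eq_mul, Fintype.sum_sum_type,
        Sum.elim_inl, Sum.elim_inr, hα, if_true, apply_ite (MvPolynomial.eval z), map_zero,
        mul_ite, mul_zero, Finset.sum_ite_eq', Finset.mem_univ, Pi.zero_apply, hP₁, hP₂] at h4
      rw [← h4]
      ring
    obtain ⟨α, hα, β, hβ, hne'⟩ := hind
    rw [← sub_ne_zero] at hne'
    have h5 : ∀ i, g (Sum.inl i) * Q₁ z = 0 ∧ g (Sum.inr i) * Q₂ z = 0 := by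
      intro i
      have ha := h3 i α hα
      have hb := h3 i β hβ
      constructor
      · refine (mul_eq_zero.1 ?_).resolve_right hne'
        linear_combination (∏ k, z k ^ e₂ β k) * ha - (∏ k, z k ^ e₂ α k) * hb
      · refine (mul_eq_zero.1 ?_).resolve_right hne'
        linear_combination (∏ k, z k ^ e₁ α k) * hb - (∏ k, z k ^ e₁ β k) * ha
    rintro (i | i)
    · exact (mul_eq_zero.1 (h5 i).1).resolve_right hQ₁
    · exact (mul_eq_zero.1 (h5 i).2).resolve_right hQ₂
  · rintro (i | i)
    · exact hker P₁ e₁ _ hP₁ h₁ i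
    · exact hker P₂ e₂ _ hP₂ h₂ i

/-! ### The combinatorics of the support set -/

variable {n : ℕ} {A : Finset (Exponent n)}

theorem nonneg_of_hasVerticalFacet (hfacet : HasVerticalFacet A) {α : Exponent n} (hα : α ∈ A) :
    0 ≤ α.2.2 := by
  have : (0 : ℝ) ≤ (α.2.2 : ℝ) :=
    hfacet.1 (toRealPoint α) (subset_convexHull ℝ _ ⟨α, hα, rfl⟩)
  exact_mod_cast this

/-- A real linear form vanishing on the exponents of the facet vanishes on the hyperplane spanned
by the facet. -/
theorem apply_eq_zero_of_forall_facet (hfacet : HasVerticalFacet A)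
    (l : ((Fin n → ℝ) × ℝ × ℝ) →ₗ[ℝ] ℝ)
    (hl : ∀ α ∈ A, α.2.2 = 0 → l (toRealPoint α) = 0) (x : Fin n → ℝ) (y : ℝ) :
    l (x, y, 0) = 0 := by
  let τ : ((Fin n → ℝ) × ℝ × ℝ) →ₗ[ℝ] ℝ := LinearMap.snd ℝ ℝ ℝ ∘ₗ LinearMap.snd ℝ _ _
  -- points on the facet are combinations of exponents on the facet
  have hV : ∀ v ∈ polytope A, v.2.2 = 0 → l v = 0 := by
    have hconv : Convex ℝ {v : (Fin n → ℝ) × ℝ × ℝ | 0 ≤ v.2.2 ∧ (v.2.2 = 0 → l v = 0)} := by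
      rintro v ⟨hv, hv'⟩ w ⟨hw, hw'⟩ a b ha hb -
      have h1 := mul_nonneg ha hv
      have h2 := mul_nonneg hb hw
      refine ⟨by simpa using add_nonneg h1 h2, fun h => ?_⟩
      have h3 : a * v.2.2 + b * w.2.2 = 0 := by simpa using h
      have h4 : a * v.2.2 = 0 := by linarith
      have h5 : b * w.2.2 = 0 := by linarith
      rw [map_add, map_smul, map_smul, smul_eq_mul, smul_eq_mul]
      rcases mul_eq_zero.1 h4 with h | h <;> rcases mul_eq_zero.1 h5 with h' | h' <;>
        simp [h, h', hv', hw']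
    intro v hv
    refine (convexHull_min ?_ hconv hv).2
    rintro _ ⟨α, hα, rfl⟩
    refine ⟨?_, fun h => hl α hα ?_⟩
    · exact hfacet.1 _ (subset_convexHull ℝ _ ⟨α, hα, rfl⟩)
    · exact Int.cast_eq_zero.1 (show (α.2.2 : ℝ) = 0 from h)
  have hspan : vectorSpan ℝ {v | v ∈ polytope A ∧ v.2.2 = 0} = LinearMap.ker τ := by
    refine Submodule.eq_of_le_of_finrank_eq ?_ ?_
    · refine Submodule.span_le.2 ?_
      rintro _ ⟨v, hv, w, hw, rfl⟩
      simp [τ, hv.2, hw.2]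
    · rw [hfacet.2]
      have h1 := LinearMap.finrank_range_add_finrank_ker τ
      have h2 : LinearMap.range τ = ⊤ := LinearMap.range_eq_top.2 fun t => ⟨(0, 0, t), rfl⟩
      rw [h2, finrank_top] at h1
      simp at h1
      omega
  have hle : LinearMap.ker τ ≤ LinearMap.ker l := by
    rw [← hspan]
    refine Submodule.span_le.2 ?_
    rintro _ ⟨v, hv, w, hw, rfl⟩
    simp [hV v hv.1 hv.2, hV w hw.1 hw.2]
  exact hle (by simp [τ] : (x, y, (0 : ℝ)) ∈ LinearMap.ker τ)

/-- The exponents of the facet are not contained in a hyperplane of `ℂⁿ⁺¹`. -/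
theorem eq_zero_of_forall_facet (hfacet : HasVerticalFacet A) (a : Fin n → ℂ) (b : ℂ)
    (h : ∀ α ∈ A, α.2.2 = 0 → ∑ j, a j * (α.1 j : ℂ) + b * (α.2.1 : ℂ) = 0) : a = 0 ∧ b = 0 := by
  have key : ∀ (a : Fin n → ℝ) (b : ℝ),
      (∀ α ∈ A, α.2.2 = 0 → ∑ j, a j * (α.1 j : ℝ) + b * (α.2.1 : ℝ) = 0) → a = 0 ∧ b = 0 := by
    intro a b h
    let l : ((Fin n → ℝ) × ℝ × ℝ) →ₗ[ℝ] ℝ :=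
      (∑ j, a j • (LinearMap.proj j ∘ₗ LinearMap.fst ℝ (Fin n → ℝ) (ℝ × ℝ))) +
        b • (LinearMap.fst ℝ ℝ ℝ ∘ₗ LinearMap.snd ℝ _ _)
    have hl : ∀ v, l v = ∑ j, a j * v.1 j + b * v.2.1 := by
      intro v
      simp [l]
    have h0 := apply_eq_zero_of_forall_facet hfacet l fun α hα hα0 => by
      rw [hl]
      exact h α hα hα0
    constructor
    · funext j
      have := h0 (Pi.single j 1) 0
      rw [hl] at this
      simpa [Pi.single_apply] using this
    · have := h0 0 1
      rw [hl] at this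
      simpa using this
  have hre := key (fun j => (a j).re) b.re fun α hα hα0 => by
    have := congrArg Complex.re (h α hα hα0)
    simpa using this
  have him := key (fun j => (a j).im) b.im fun α hα hα0 => by
    have := congrArg Complex.im (h α hα hα0)
    simpa using this
  constructor
  · funext j
    exact Complex.ext (congrFun hre.1 j) (congrFun him.1 j)
  · exact Complex.ext hre.2 him.2

/-- If `A` generates a lattice projecting onto `ℤⁿ`, then only the unit of the torus `(ℂ ∖ 0)ⁿ` is
annihilated by all the exponents. -/
theorem eq_one_of_forall_prod_zpow_eq_one (hind : verticalIndex A = 1) (u : Fin n → ℂ)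
    (hu : ∀ j, u j ≠ 0) (h : ∀ α ∈ A, ∏ j, u j ^ α.1 j = 1) : u = 1 := by
  let S : AddSubgroup (Exponent n) :=
    { carrier := {α | ∏ j, u j ^ α.1 j = 1}
      zero_mem' := by simp
      add_mem' := fun {α β} hα hβ => by
        have h1 : ∏ j, u j ^ α.1 j = 1 := hα
        have h2 : ∏ j, u j ^ β.1 j = 1 := hβ
        simp [zpow_add₀ (hu _), Finset.prod_mul_distrib, h1, h2]
      neg_mem' := fun {α} hα => by
        have h1 : ∏ j, u j ^ α.1 j = 1 := hα
        simp [h1] }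
  have hle : AddSubgroup.closure (A : Set (Exponent n)) ≤ S :=
    (AddSubgroup.closure_le S).2 fun α hα => h α hα
  have htop := AddSubgroup.index_eq_one.1 hind
  funext j
  have hj : (Pi.single j 1 : Fin n → ℤ) ∈ (AddSubgroup.closure (A : Set (Exponent n))).map
      (AddMonoidHom.fst (Fin n → ℤ) (ℤ × ℤ)) := by
    rw [htop]
    trivial
  obtain ⟨α, hα, hαj⟩ := hj
  have h1 : ∏ j, u j ^ α.1 j = 1 := hle hα
  have h2 : α.1 = Pi.single j 1 := hαj
  rw [h2, Finset.prod_eq_single j (fun b _ hb => by simp [hb]) (by simp)] at h1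
  simpa using h1

theorem prod_zpow_eq_zpow_sum {ι : Type} {w : ℂ} (hw : w ≠ 0) (s : Finset ι) (f : ι → ℤ) :
    ∏ k ∈ s, w ^ f k = w ^ ∑ k ∈ s, f k := by
  classical
  induction s using Finset.induction_on with
  | empty => simp
  | insert k s hk ih => rw [Finset.prod_insert hk, Finset.sum_insert hk, ih, zpow_add₀ hw]

/-- The points of the torus `(ℂ ∖ 0)ⁿ` annihilated by the exponents of the facet form a finite
group: an invertible minor `D` of the matrix of these exponents yields `uⱼ ^ D = 1`. -/
theorem finite_setOf_forall_facet_prod_zpow_eq_one (hfacet : HasVerticalFacet A) :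
    {u : Fin n → ℂ | (∀ j, u j ≠ 0) ∧
      ∀ α ∈ A, α.2.2 = 0 → ∏ j, u j ^ α.1 j = 1}.Finite := by
  let T := {α : A // α.1.2.2 = 0}
  let M : Matrix (Fin n) T ℂ := fun j α => (α.1.1.1 j : ℂ)
  have hM : LinearIndependent ℂ M.row := by
    rw [Fintype.linearIndependent_iff]
    intro g hg
    have := eq_zero_of_forall_facet hfacet g 0 fun α hα hα0 => by
      have := congrFun hg ⟨⟨α, hα⟩, hα0⟩
      simpa [M, Matrix.row] using this
    exact congrFun this.1
  obtain ⟨e, he⟩ := exists_embedding_det_ne_zero M hM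
  let B : Matrix (Fin n) (Fin n) ℤ := fun j k => (e k).1.1.1 j
  have hB : B.det ≠ 0 := by
    intro h
    apply he
    have h1 : M.submatrix id e = B.map (Int.castRingHom ℂ) := rfl
    rw [h1, ← RingHom.mapMatrix_apply, ← RingHom.map_det, h, map_zero]
  refine (Set.Finite.pi' (t := fun _ : Fin n => {w : ℂ | w ^ B.det.natAbs = 1})
    fun _ => ?_).subset ?_
  · have h0 : B.det.natAbs ≠ 0 := Int.natAbs_ne_zero.2 hB
    refine ((Polynomial.nthRoots B.det.natAbs (1 : ℂ)).toFinset.finite_toSet).subset fun w hw => ?_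
    simpa [Polynomial.mem_nthRoots (Nat.pos_of_ne_zero h0)] using hw
  · rintro u ⟨hu, h⟩ j
    have h1 : ∏ k, (∏ j', u j' ^ B j' k) ^ B.adjugate k j = 1 :=
      Finset.prod_eq_one fun k _ => by
        rw [h _ (e k).1.2 (e k).2, one_zpow]
    have h2 : ∏ k, (∏ j', u j' ^ B j' k) ^ B.adjugate k j = u j ^ B.det := by
      have h3 : ∀ j', ∏ k, (u j' ^ B j' k) ^ B.adjugate k j = u j' ^ (B * B.adjugate) j' j := by
        intro j'
        rw [Matrix.mul_apply]
        simp only [← zpow_mul]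
        exact prod_zpow_eq_zpow_sum (hu j') _ _
      simp only [← Finset.prod_zpow]
      rw [Finset.prod_comm, Finset.prod_congr rfl fun j' _ => h3 j', Matrix.mul_adjugate,
        Finset.prod_eq_single j (fun b _ hb => by simp [hb]) (by simp)]
      simp
    rw [h2] at h1
    rcases Int.natAbs_eq B.det with h4 | h4
    · rw [h4, zpow_natCast] at h1
      exact h1
    · rw [h4, zpow_neg, zpow_natCast, inv_eq_one] at h1
      exact h1

/-! ### Generic tuples -/

theorem Generic.of_forall {P : Tuple A → Prop} (h : ∀ c, P c) : Generic A P :=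
  ⟨1, one_ne_zero, fun c _ => h c⟩

theorem Generic.mono {P Q : Tuple A → Prop} (hP : Generic A P) (h : ∀ c, P c → Q c) :
    Generic A Q :=
  let ⟨H, hne, hH⟩ := hP
  ⟨H, hne, fun c hc => h c (hH c hc)⟩

theorem Generic.and {P Q : Tuple A → Prop} (hP : Generic A P) (hQ : Generic A Q) :
    Generic A fun c => P c ∧ Q c := by
  obtain ⟨H, hne, hH⟩ := hP
  obtain ⟨H', hne', hH'⟩ := hQ
  refine ⟨H * H', mul_ne_zero hne hne', fun c hc => ?_⟩
  rw [map_mul] at hc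
  exact ⟨hH c (left_ne_zero_of_mul hc), hH' c (right_ne_zero_of_mul hc)⟩

theorem Generic.forall_mem_finite {ι : Type*} {s : Set ι} (hs : s.Finite) {P : ι → Tuple A → Prop}
    (h : ∀ i ∈ s, Generic A (P i)) : Generic A fun c => ∀ i ∈ s, P i c := by
  classical
  choose H hne hH using h
  refine ⟨∏ i : hs.toFinset, H i (hs.mem_toFinset.1 i.2),
    Finset.prod_ne_zero_iff.2 fun i _ => hne _ _, fun c hc i hi => hH i hi c ?_⟩
  rw [map_prod, Finset.prod_ne_zero_iff] at hc
  exact hc ⟨i, hs.mem_toFinset.2 hi⟩ (Finset.mem_univ _)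

/-- The value at `z` of the monomial with exponent `α`, without its power of `t`. -/
def character (z : Point n) (α : Exponent n) : ℂ :=
  (∏ j, z.1 j ^ α.1 j) * z.2.1 ^ α.2.1

/-- The value at `u ∈ (ℂ ∖ 0)ⁿ` of the monomial in `x₁, …, xₙ` with exponent `α`. -/
def twist (u : Fin n → ℂ) (α : Exponent n) : ℂ := ∏ j, u j ^ α.1 j

/-- The point `z` lies over a common zero of the facet truncations in the torus `(ℂ ∖ 0)ⁿ⁺¹`. -/
structure IsFacetZero (c : Tuple A) (z : Point n) : Prop where
  fst_ne_zero : ∀ j, z.1 j ≠ 0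
  snd_ne_zero : z.2.1 ≠ 0
  slice_eq_zero : ∀ i, slice c i 0 z = 0

/-- The condition that the zeros of the facet truncations in `(ℂ ∖ 0)ⁿ⁺¹` are nondegenerate; the
derivatives are the logarithmic ones. -/
def HasNondegenerateZeros (c : Tuple A) : Prop :=
  ∀ z, IsFacetZero c z → ∀ (ξ : Fin n → ℂ) (η : ℂ),
    (∀ i, ∑ α : A with α.1.2.2 = 0, c i α * character z α *
      (∑ j, ξ j * (α.1.1 j : ℂ) + η * (α.1.2.1 : ℂ)) = 0) → ξ = 0 ∧ η = 0

/-- The condition that two zeros of the facet truncations with the same `y` are not distinguished by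
the monomials on the facet. -/
def HasNoFacetCollision (c : Tuple A) : Prop :=
  ∀ z w, IsFacetZero c z → IsFacetZero c w → z.2.1 = w.2.1 →
    ∀ α ∈ A, α.2.2 = 0 → twist (fun j => w.1 j / z.1 j) α = 1

/-- The condition that multiplication of a zero of the facet truncations by `u` changes all the
slices of level `K`, and that the vector of these changes is not tangent to the fibres of `y`. -/
structure IsTransverseAt (u : Fin n → ℂ) (K : ℕ) (c : Tuple A) : Prop where
  ne_zero : ∀ z, IsFacetZero c z → ∀ i,
    ∑ α : A with α.1.2.2 = (K : ℤ), c i α * character z α * (1 - twist u α) ≠ 0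
  transverse : ∀ z, IsFacetZero c z → ∀ (ξ : Fin n → ℂ) (ζ : ℂ),
    (∀ i, ∑ α : A with α.1.2.2 = 0, c i α * character z α * ∑ j, ξ j * (α.1.1 j : ℂ) +
      ζ * ∑ α : A with α.1.2.2 = (K : ℤ), c i α * character z α * (1 - twist u α) = 0) → ζ = 0

/-- The exponent `α` as a function on the coordinates `y` and `xⱼ`. -/
def expo (α : A) (o : Option (Fin n)) : ℤ := o.elim α.1.2.1 α.1.1

/-- The coordinates `y` and `xⱼ` of a point. -/
def coords (z : Point n) (o : Option (Fin n)) : ℂ := o.elim z.2.1 z.1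

theorem prod_coords_zpow_expo (z : Point n) (α : A) :
    ∏ k, coords z k ^ expo α k = character z α := by
  rw [Fintype.prod_option, mul_comm]
  rfl

theorem IsFacetZero.coords_ne_zero {c : Tuple A} {z : Point n} (hz : IsFacetZero c z) :
    ∀ o, coords z o ≠ 0
  | none => hz.snd_ne_zero
  | some j => hz.fst_ne_zero j

/-- The indicator function of the exponents of the facet. -/
def facetForm (α : A) : ℂ := if α.1.2.2 = 0 then 1 else 0

theorem IsFacetZero.sum_facetForm {c : Tuple A} {z : Point n} (hz : IsFacetZero c z)
    (i : Fin (n + 1)) :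
    ∑ α : A, c i α * facetForm α * ∏ k, coords z k ^ expo α k = 0 := by
  have h := hz.slice_eq_zero i
  rw [slice, Finset.sum_filter] at h
  rw [← h]
  refine Finset.sum_congr rfl fun α _ => ?_
  rw [prod_coords_zpow_expo, facetForm, Nat.cast_zero]
  split_ifs <;> simp [character]

theorem sum_ite_mul_prod_coords (c : Tuple A) (z : Point n) (i : Fin (n + 1)) (p : A → Prop)
    [DecidablePred p] (φ : A → ℂ) :
    ∑ α : A, c i α * (if p α then φ α else 0) * ∏ k, coords z k ^ expo α k =
      ∑ α : A with p α, c i α * character z α * φ α := by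
  rw [Finset.sum_filter]
  refine Finset.sum_congr rfl fun α _ => ?_
  rw [prod_coords_zpow_expo]
  split_ifs <;> ring

theorem generic_hasNondegenerateZeros (hzero : (0 : Exponent n) ∈ A)
    (hfacet : HasVerticalFacet A) : Generic A HasNondegenerateZeros := by
  obtain ⟨H, hne, hH⟩ := exists_ne_zero_forall_kernel_eq_zero (T := A) (ι := Option (Fin n))
    (I := Fin (n + 1)) (J := Option (Fin n)) expo (by simp) (by simp) facetForm
    (fun o α => if α.1.2.2 = 0 then (expo α o : ℂ) else 0) (by
      intro a₀ a h
      have h0 : a₀ = 0 := by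
        have := h ⟨0, hzero⟩
        have he : ∀ o, expo (⟨0, hzero⟩ : A) o = 0 := by rintro (_ | _) <;> rfl
        simpa [facetForm, he] using this
      have h1 := eq_zero_of_forall_facet hfacet (fun j => a (some j)) (a none) fun α hα hα0 => by
        have := h ⟨α, hα⟩
        simp only [h0, zero_mul, zero_add, hα0, if_true, Fintype.sum_option] at this
        rw [add_comm]
        exact this
      refine ⟨h0, funext fun o => ?_⟩
      cases o with
      | none => exact h1.2
      | some j => exact congrFun h1.1 j)
  refine ⟨H, hne, fun c hc z hz ξ η h => ?_⟩
  have := hH _ (coords z) hc hz.coords_ne_zero hz.sum_facetForm (fun o => o.elim η ξ) fun i => by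
    refine Eq.trans ?_ (h i)
    simp only [sum_ite_mul_prod_coords, Finset.mul_sum]
    rw [Finset.sum_comm]
    refine Finset.sum_congr rfl fun α _ => ?_
    rw [Fintype.sum_option, mul_add, Finset.mul_sum, add_comm]
    simp only [Option.elim, expo]
    congr 1
    · exact Finset.sum_congr rfl fun j _ => by ring
    · ring
  exact ⟨funext fun j => congrFun this (some j), congrFun this none⟩

theorem generic_hasNoFacetCollision (hzero : (0 : Exponent n) ∈ A) :
    Generic A HasNoFacetCollision := by
  -- the parameters are the common coordinate `y` and the coordinates `x` of the two points
  let e : Bool → A → Option (Fin n ⊕ Fin n) → ℤ := fun b α o =>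
    o.elim α.1.2.1 (Sum.elim (fun j => if b then α.1.1 j else 0)
      (fun j => if b then 0 else α.1.1 j))
  obtain ⟨H, hne, hH⟩ := exists_ne_zero_eval_eq_zero_of_two_points (T := A)
    (ι := Option (Fin n ⊕ Fin n)) (I := Fin (n + 1)) (e true) (e false)
    (by simp; omega) (Finset.univ.filter fun α => α.1.2.2 = 0)
  refine ⟨H, hne, fun c hc z w hz hw hy α hα hα0 => ?_⟩
  by_contra htw
  let v : Option (Fin n ⊕ Fin n) → ℂ := fun o => o.elim z.2.1 (Sum.elim z.1 w.1)
  have hv₁ : ∀ α, ∏ k, v k ^ e true α k = character z α := by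
    intro α
    simp [Fintype.prod_option, v, e, character, mul_comm]
  have hv₂ : ∀ α, ∏ k, v k ^ e false α k = character w α := by
    intro α
    simp [Fintype.prod_option, v, e, character, mul_comm, hy]
  refine hc (hH _ v ?_ ⟨⟨0, hzero⟩, by simp, ⟨α, hα⟩, by simpa using hα0, ?_⟩ ?_ ?_)
  · rintro (_ | j | j)
    · exact hz.snd_ne_zero
    · exact hz.fst_ne_zero j
    · exact hw.fst_ne_zero j
  · rw [hv₁, hv₂, hv₁, hv₂]
    intro h
    have h0 : ∀ p : Point n, character p 0 = 1 := fun p => by simp [character]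
    rw [h0, h0, one_mul, mul_one] at h
    apply htw
    have hz' : ∏ j, z.1 j ^ α.1 j ≠ 0 :=
      Finset.prod_ne_zero_iff.2 fun j _ => zpow_ne_zero _ (hz.fst_ne_zero j)
    have h1 := mul_right_cancel₀ (b := z.2.1 ^ α.2.1) (zpow_ne_zero _ hz.snd_ne_zero)
      (show (∏ j, w.1 j ^ α.1 j) * _ = (∏ j, z.1 j ^ α.1 j) * _ by
        rw [character, character, ← hy] at h
        exact h)
    simp only [twist, div_zpow, Finset.prod_div_distrib]
    rw [h1, div_self hz']
  · intro i
    simp only [hv₁]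
    have := hz.slice_eq_zero i
    simpa [slice, character] using this
  · intro i
    simp only [hv₂]
    have := hw.slice_eq_zero i
    simpa [slice, character] using this

theorem generic_isTransverseAt (hzero : (0 : Exponent n) ∈ A) (hfacet : HasVerticalFacet A)
    (u : Fin n → ℂ) {K : ℕ} (hK : K ≠ 0) {β : Exponent n} (hβ : β ∈ A) (hβK : β.2.2 = (K : ℤ))
    (hu : twist u β ≠ 1) : Generic A (IsTransverseAt u K) := by
  have hK' : (K : ℤ) ≠ 0 := by exact_mod_cast hK
  let D : A → ℂ := fun α => if α.1.2.2 = (K : ℤ) then 1 - twist u α else 0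
  have hD0 : ∀ α : A, α.1.2.2 = 0 → D α = 0 := fun α h => if_neg (by rw [h]; exact hK'.symm)
  have hDβ : D ⟨β, hβ⟩ ≠ 0 := by
    simp only [D, hβK, if_true]
    exact sub_ne_zero.2 hu.symm
  have hβ0 : ¬ β.2.2 = 0 := by rw [hβK]; exact hK'
  -- a single slice of level `K` does not vanish
  have h₁ : Generic A fun c => ∀ i ∈ (Set.univ : Set (Fin (n + 1))), ∀ z, IsFacetZero c z →
      ∑ α : A with α.1.2.2 = (K : ℤ), c i α * character z α * (1 - twist u α) ≠ 0 := by
    refine Generic.forall_mem_finite Set.finite_univ fun i _ => ?_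
    obtain ⟨H, hne, hH⟩ := exists_ne_zero_eval_eq_zero_of_combination (T := A)
      (ι := Option (Fin n)) (I := Fin (n + 1)) (J := Unit) (ρ := Empty) expo
      (Pi.single i 1) (by simp) facetForm (fun _ => D) (by
        intro a₀ a h
        have h0 : a₀ = 0 := by
          have := h ⟨0, hzero⟩
          simpa [facetForm, hD0 ⟨0, hzero⟩ rfl] using this
        refine ⟨h0, funext fun _ => ?_⟩
        have := h ⟨β, hβ⟩
        simpa [h0, hDβ] using this)
    refine ⟨H, hne, fun c hc z hz h => hc ?_⟩
    refine hH _ (coords z) Empty.elim hz.coords_ne_zero ⟨i, by simp⟩ hz.sum_facetForm fun _ => ?_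
    rw [Finset.sum_eq_single i (fun b _ hb => by simp [hb]) (by simp),
      sum_ite_mul_prod_coords, h, mul_zero]
  have h₂ : Generic A fun c => ∀ z, IsFacetZero c z → ∀ (ξ : Fin n → ℂ) (ζ : ℂ),
      (∀ i, ∑ α : A with α.1.2.2 = 0, c i α * character z α * ∑ j, ξ j * (α.1.1 j : ℂ) +
        ζ * ∑ α : A with α.1.2.2 = (K : ℤ), c i α * character z α * (1 - twist u α) = 0) →
        ζ = 0 := by
    obtain ⟨H, hne, hH⟩ := exists_ne_zero_forall_kernel_eq_zero (T := A) (ι := Option (Fin n))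
      (I := Fin (n + 1)) (J := Option (Fin n)) expo (by simp) (by simp) facetForm
      (fun o α => o.elim (D α) fun j => if α.1.2.2 = 0 then (α.1.1 j : ℂ) else 0) (by
        intro a₀ a h
        have h0 : a₀ = 0 := by
          have := h ⟨0, hzero⟩
          simpa [facetForm, Fintype.sum_option, hD0 ⟨0, hzero⟩ rfl] using this
        have hnone : a none = 0 := by
          have := h ⟨β, hβ⟩
          simpa [h0, Fintype.sum_option, hβ0, hDβ] using this
        have h1 := eq_zero_of_forall_facet hfacet (fun j => a (some j)) 0 fun α hα hα0 => by
          have := h ⟨α, hα⟩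
          simpa [h0, hnone, Fintype.sum_option, hα0] using this
        refine ⟨h0, funext fun o => ?_⟩
        cases o with
        | none => exact hnone
        | some j => exact congrFun h1.1 j)
    refine ⟨H, hne, fun c hc z hz ξ ζ h => ?_⟩
    have := hH _ (coords z) hc hz.coords_ne_zero hz.sum_facetForm (fun o => o.elim ζ ξ) fun i => by
      refine Eq.trans ?_ (h i)
      rw [Fintype.sum_option, add_comm]
      simp only [Option.elim, D, sum_ite_mul_prod_coords, Finset.mul_sum]
      rw [Finset.sum_comm]
      congr 1
      exact Finset.sum_congr rfl fun α _ => Finset.sum_congr rfl fun j _ => by ring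
    exact congrFun this none
  exact (h₁.and h₂).mono fun c hc => ⟨fun z hz i => hc.1 i trivial z hz, hc.2⟩

/-- The genericity conditions under which the contact order is computed. -/
structure IsNondegenerate (c : Tuple A) : Prop where
  zeros : HasNondegenerateZeros c
  collision : HasNoFacetCollision c
  transverse : ∀ u : Fin n → ℂ, (∀ j, u j ≠ 0) → (∀ α ∈ A, α.2.2 = 0 → twist u α = 1) →
    ∀ K : ℕ, K ≠ 0 → ∀ β ∈ A, β.2.2 = (K : ℤ) → twist u β ≠ 1 → IsTransverseAt u K c

theorem generic_isNondegenerate (hzero : (0 : Exponent n) ∈ A) (hfacet : HasVerticalFacet A) :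
    Generic A IsNondegenerate := by
  have hfin := finite_setOf_forall_facet_prod_zpow_eq_one hfacet
  have h := Generic.forall_mem_finite (A := A) (P := fun u c => ∀ β ∈ (A : Set (Exponent n)),
    β.2.2 ≠ 0 → twist u β ≠ 1 → IsTransverseAt u β.2.2.toNat c) hfin fun u _ =>
    Generic.forall_mem_finite A.finite_toSet fun β hβ => by
      by_cases h0 : β.2.2 ≠ 0 ∧ twist u β ≠ 1
      · have hnn := nonneg_of_hasVerticalFacet hfacet hβ
        refine (generic_isTransverseAt hzero hfacet u (K := β.2.2.toNat) ?_ hβ ?_ h0.2).mono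
          fun c hc _ _ => hc
        · omega
        · omega
      · exact Generic.of_forall fun c h1 h2 => absurd ⟨h1, h2⟩ h0
  refine ((generic_hasNondegenerateZeros hzero hfacet).and
    ((generic_hasNoFacetCollision hzero).and h)).mono fun c hc => ⟨hc.1, hc.2.1, ?_⟩
  intro u hu h1 K hK β hβ hβK htw
  have := hc.2.2 u ⟨hu, h1⟩ β hβ (by rw [hβK]; exact_mod_cast hK) htw
  rwa [hβK, Int.toNat_natCast] at this

/-! ### Orders of vanishing and contact of plane arcs -/

open Asymptotics in
theorem analyticOrderAt_le_of_isBigO {f g : ℂ → ℂ} {z₀ : ℂ} (hf : AnalyticAt ℂ f z₀)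
    (hg : AnalyticAt ℂ g z₀) (h : f =O[𝓝 z₀] g) : analyticOrderAt g z₀ ≤ analyticOrderAt f z₀ := by
  by_contra! hlt
  obtain ⟨k, hk⟩ := ENat.ne_top_iff_exists.1 (ne_top_of_lt hlt)
  obtain ⟨F, hF, hF0, hfF⟩ := hf.analyticOrderAt_eq_natCast.1 hk.symm
  have hg' : ((k + 1 : ℕ) : ℕ∞) ≤ analyticOrderAt g z₀ := by
    rw [← hk] at hlt
    exact_mod_cast Order.add_one_le_of_lt hlt
  obtain ⟨G, hG, hgG⟩ := (natCast_le_analyticOrderAt hg).1 hg'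
  -- dividing by `(z - z₀) ^ k` shows that `F` vanishes at `z₀`
  have h1 : F =O[𝓝[≠] z₀] fun z => (z - z₀) * G z := by
    obtain ⟨C, hC⟩ := h.bound
    refine IsBigO.of_bound C ?_
    filter_upwards [self_mem_nhdsWithin, nhdsWithin_le_nhds hC, nhdsWithin_le_nhds hfF,
      nhdsWithin_le_nhds hgG] with z hz hCz hfz hgz
    have hz' : 0 < ‖z - z₀‖ ^ k := pow_pos (norm_pos_iff.2 (sub_ne_zero.2 hz)) k
    rw [hfz, hgz, norm_smul, norm_smul, norm_pow, norm_pow] at hCz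
    rw [norm_mul]
    refine le_of_mul_le_mul_left ?_ hz'
    calc _ ≤ _ := hCz
      _ = _ := by ring
  have h2 : Tendsto (fun z => (z - z₀) * G z) (𝓝[≠] z₀) (𝓝 0) := by
    have : ContinuousAt (fun z => (z - z₀) * G z) z₀ :=
      (continuousAt_id.sub continuousAt_const).mul hG.continuousAt
    simpa [ContinuousAt] using this.tendsto.mono_left nhdsWithin_le_nhds
  exact hF0 (tendsto_nhds_unique (hF.continuousAt.tendsto.mono_left nhdsWithin_le_nhds)
    (h1.trans_tendsto h2))

open Asymptotics in
theorem analyticOrderAt_eq_of_isLittleO {f : ℂ → ℂ} (hf : AnalyticAt ℂ f 0) {a : ℂ} (ha : a ≠ 0)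
    {K : ℕ} (h : (fun t => f t - t ^ K * a) =o[𝓝 0] fun t : ℂ => t ^ K) :
    analyticOrderAt f 0 = K := by
  have hmon : AnalyticAt ℂ (fun t : ℂ => t ^ K) 0 := by fun_prop
  have hord : analyticOrderAt (fun t : ℂ => t ^ K) 0 = K := by
    have := analyticOrderAt_centeredMonomial (𝕜 := ℂ) (z₀ := 0) (n := K)
    simp only [sub_zero] at this
    exact this
  have h1 : (fun t : ℂ => t ^ K * a) =O[𝓝 0] fun t : ℂ => t ^ K := by
    simpa only [mul_comm] using isBigO_const_mul_self a (fun t : ℂ => t ^ K) (𝓝 0)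
  have h2 : (fun t : ℂ => t ^ K) =O[𝓝 0] fun t : ℂ => t ^ K * a := by
    simpa only [mul_comm] using isBigO_self_const_mul ha (fun t : ℂ => t ^ K) (𝓝 0)
  have h3 : f =O[𝓝 0] fun t : ℂ => t ^ K := by
    simpa using h.isBigO.add h1
  have h4 : (fun t : ℂ => t ^ K) =O[𝓝 0] f := by
    have h5 := h.trans_isBigO h2
    have h6 := h2.trans h5.right_isBigO_add
    simpa using h6
  rw [← hord]
  exact le_antisymm (analyticOrderAt_le_of_isBigO hmon hf h4)
    (analyticOrderAt_le_of_isBigO hf hmon h3)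

/-- An injective germ of holomorphic function has nonzero derivative: a germ of order `k` is the
`k`-th power of a local coordinate `σ`, and it takes equal values where the values of `σ` differ by
a `k`-th root of unity. -/
theorem deriv_ne_zero_of_injOn {f : ℂ → ℂ} (hf : AnalyticAt ℂ f 0) {U : Set ℂ} (hU : U ∈ 𝓝 0)
    (hinj : Set.InjOn f U) : deriv f 0 ≠ 0 := by
  have hf' : AnalyticAt ℂ (fun s => f s - f 0) 0 := by fun_prop
  have hfin : analyticOrderAt (fun s => f s - f 0) 0 ≠ ⊤ := by
    intro h
    rw [analyticOrderAt_eq_top] at h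
    have h1 : ∀ᶠ s in 𝓝[≠] (0 : ℂ), f s - f 0 = 0 ∧ s ∈ U ∧ s ≠ 0 := by
      filter_upwards [nhdsWithin_le_nhds h, nhdsWithin_le_nhds hU, self_mem_nhdsWithin]
        with s h1 h2 h3 using ⟨h1, h2, h3⟩
    obtain ⟨s, hs, hsU, hs0⟩ := h1.exists
    exact hs0 (hinj hsU (mem_of_mem_nhds hU) (sub_eq_zero.1 hs))
  obtain ⟨k, hk⟩ := ENat.ne_top_iff_exists.1 hfin
  obtain ⟨g, hg, hg0, hfg⟩ := hf'.analyticOrderAt_eq_natCast.1 hk.symm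
  have hk0 : k ≠ 0 := by
    rintro rfl
    have := hfg.self_of_nhds
    simp at this
    exact hg0 this.symm
  obtain ⟨a, ha⟩ := IsAlgClosed.exists_pow_nat_eq (g 0) (Nat.pos_of_ne_zero hk0)
  have ha0 : a ≠ 0 := by
    rintro rfl
    rw [zero_pow hk0] at ha
    exact hg0 ha.symm
  have hkC : (k : ℂ) ≠ 0 := by exact_mod_cast hk0
  let σ : ℂ → ℂ := fun s => s * (a * Complex.exp (Complex.log (g s / g 0) / k))
  have hslit : g 0 / g 0 ∈ Complex.slitPlane := by
    rw [div_self hg0]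
    exact Complex.one_mem_slitPlane
  have hr : AnalyticAt ℂ (fun s => a * Complex.exp (Complex.log (g s / g 0) / k)) 0 :=
    analyticAt_const.mul (((hg.div analyticAt_const hg0).clog hslit).div analyticAt_const hkC).cexp
  have hσ : AnalyticAt ℂ σ 0 := analyticAt_id.mul hr
  have hσ0 : σ 0 = 0 := by simp [σ]
  have hσk : ∀ᶠ s in 𝓝 0, f s - f 0 = σ s ^ k := by
    filter_upwards [hfg, hg.continuousAt.eventually_ne hg0] with s hs hgs
    rw [hs]
    simp only [σ, mul_pow, ha, ← Complex.exp_nat_mul, mul_div_cancel₀ _ hkC, sub_zero, smul_eq_mul]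
    rw [Complex.exp_log (div_ne_zero hgs hg0)]
    field_simp
  have hσ' : HasStrictDerivAt σ a 0 := by
    have h1 := hσ.hasStrictDerivAt
    have h2 : HasDerivAt σ a 0 := by
      have h3 := (hasDerivAt_id' (0 : ℂ)).fun_mul hr.differentiableAt.hasDerivAt
      simpa [hg0] using h3
    rwa [h2.deriv] at h1
  by_cases hk1 : k = 1
  · subst hk1
    intro h0
    have h1 : HasDerivAt f a 0 := by
      have h2 : (fun s => σ s + f 0) =ᶠ[𝓝 0] f := by
        filter_upwards [hσk] with s hs
        rw [pow_one] at hs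
        rw [← hs]
        ring
      exact (hσ'.hasDerivAt.add_const (f 0)).congr_of_eventuallyEq h2.symm
    exact ha0 (h1.deriv ▸ h0)
  · exfalso
    let ω : ℂ := Complex.exp (2 * Real.pi * Complex.I / k)
    have hω : IsPrimitiveRoot ω k := Complex.isPrimitiveRoot_exp k hk0
    have hω1 : ω ≠ 1 := hω.ne_one (by omega)
    have hmap := hσ'.map_nhds_eq ha0
    rw [hσ0] at hmap
    have hV : ∀ᶠ w in 𝓝 (0 : ℂ), ∃ s ∈ U, f s - f 0 = σ s ^ k ∧ σ s = w := by
      rw [← hmap]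
      refine eventually_map.2 ?_
      filter_upwards [hU, hσk] with s h1 h2 using ⟨s, h1, h2, rfl⟩
    have hV' : ∀ᶠ w in 𝓝 (0 : ℂ), ∃ s ∈ U, f s - f 0 = σ s ^ k ∧ σ s = ω * w := by
      have : Tendsto (fun w => ω * w) (𝓝 0) (𝓝 0) := by
        simpa using (continuous_const_mul ω).tendsto 0
      exact this.eventually hV
    have hex : ∀ᶠ w in 𝓝[≠] (0 : ℂ), (∃ s ∈ U, f s - f 0 = σ s ^ k ∧ σ s = w) ∧
        (∃ s ∈ U, f s - f 0 = σ s ^ k ∧ σ s = ω * w) ∧ w ≠ 0 := by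
      filter_upwards [nhdsWithin_le_nhds hV, nhdsWithin_le_nhds hV', self_mem_nhdsWithin]
        with w h1 h2 h3 using ⟨h1, h2, h3⟩
    obtain ⟨w, ⟨s₁, hs₁, h₁, hw₁⟩, ⟨s₂, hs₂, h₂, hw₂⟩, hw⟩ := hex.exists
    have h3 : f s₁ = f s₂ := by
      rw [hw₁] at h₁
      rw [hw₂, mul_pow, hω.pow_eq_one, one_mul, ← h₁] at h₂
      exact (sub_left_inj.1 h₂).symm
    have h4 := hinj hs₁ hs₂ h3
    rw [h4, hw₂] at hw₁
    exact hω1 (mul_right_cancel₀ hw (hw₁.trans (one_mul w).symm))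

/-- The order of contact of two arcs on the graphs of `y₁` and `y₂`, parametrized by local
coordinates `τ₁` and `τ₂`, is the order of vanishing of `y₂ - y₁`. -/
theorem contactOrder_eq_analyticOrderAt_sub {y₁ y₂ τ₁ τ₂ : ℂ → ℂ} {φ ψ : ℂ → ℂ × ℂ}
    (hy₁ : AnalyticAt ℂ y₁ 0) (hy₂ : AnalyticAt ℂ y₂ 0) (hy : y₁ 0 = y₂ 0)
    (hτ₁ : AnalyticAt ℂ τ₁ 0) (hτ₁0 : τ₁ 0 = 0) (hτ₁' : deriv τ₁ 0 ≠ 0)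
    (hτ₂ : AnalyticAt ℂ τ₂ 0) (hτ₂0 : τ₂ 0 = 0) (hτ₂' : deriv τ₂ 0 ≠ 0)
    (hφ : ∀ᶠ s in 𝓝 0, φ s = (y₁ (τ₁ s), τ₁ s)) (hψ : ∀ᶠ s in 𝓝 0, ψ s = (y₂ (τ₂ s), τ₂ s)) :
    contactOrder φ ψ = analyticOrderAt (fun t => y₂ t - y₁ t) 0 := by
  have hφ0 : φ 0 = (y₁ 0, 0) := by rw [hφ.self_of_nhds, hτ₁0]
  -- orders along `ψ` may be computed in the coordinate `t`
  have hord : ∀ h : ℂ × ℂ → ℂ, analyticOrderAt (fun s => h (ψ s)) 0 =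
      analyticOrderAt (fun t => h (y₂ t, t)) 0 := by
    intro h
    have h1 : (fun s => h (ψ s)) =ᶠ[𝓝 0] (fun t => h (y₂ t, t)) ∘ τ₂ := by
      filter_upwards [hψ] with s hs
      rw [hs]
      rfl
    rw [analyticOrderAt_congr h1, analyticOrderAt_comp_of_deriv_ne_zero hτ₂ hτ₂', hτ₂0]
  refine le_antisymm ?_ ?_
  · refine iInf_le_of_le (fun q => q.1 - y₁ q.2) (iInf_le_of_le ?_ (iInf_le_of_le ?_ ?_))
    · rw [hφ0]
      have h2 : AnalyticAt ℂ (fun q : ℂ × ℂ => y₁ q.2) (y₁ 0, 0) :=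
        AnalyticAt.fun_comp (g := y₁) (f := fun q : ℂ × ℂ => q.2) hy₁ analyticAt_snd
      exact analyticAt_fst.sub h2
    · filter_upwards [hφ] with s hs
      rw [hs, sub_self]
    · exact (hord fun q => q.1 - y₁ q.2).le
  · refine le_iInf fun h => le_iInf fun hh => le_iInf fun hvan => ?_
    rw [hord]
    rw [hφ0] at hh
    have hvan' : ∀ᶠ t in 𝓝 (0 : ℂ), h (y₁ t, t) = 0 := by
      have hmap := hτ₁.hasStrictDerivAt.map_nhds_eq hτ₁'
      rw [hτ₁0] at hmap
      rw [← hmap]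
      refine eventually_map.2 ?_
      filter_upwards [hvan, hφ] with s h1 h2
      rwa [← h2]
    have hc₁ : ContinuousAt (fun t => (y₁ t, t)) (0 : ℂ) := hy₁.continuousAt.prodMk continuousAt_id
    have hc₂ : ContinuousAt (fun t => (y₂ t, t)) (0 : ℂ) := hy₂.continuousAt.prodMk continuousAt_id
    refine analyticOrderAt_le_of_isBigO ?_ (hy₂.sub hy₁) ?_
    · rw [hy] at hh
      exact AnalyticAt.fun_comp (g := h) hh (hy₂.prod analyticAt_id)
    · -- `h` is Lipschitz near the base point and vanishes on the graph of `y₁`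
      have h1 := hh.hasStrictFDerivAt.isBigO_sub
      have h2 : Tendsto (fun t : ℂ => ((y₂ t, t), (y₁ t, t))) (𝓝 0) (𝓝 ((y₁ 0, 0), (y₁ 0, 0))) := by
        refine Tendsto.prodMk_nhds ?_ hc₁.tendsto
        have := hc₂.tendsto
        rwa [← hy] at this
      have h3 := h1.comp_tendsto h2
      have h4 : (fun t => h (y₂ t, t)) =ᶠ[𝓝 0]
          ((fun p : (ℂ × ℂ) × ℂ × ℂ => h p.1 - h p.2) ∘ fun t : ℂ => ((y₂ t, t), (y₁ t, t))) := by
        filter_upwards [hvan'] with t ht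
        simp [ht]
      refine (h3.congr' h4.symm (EventuallyEq.refl _ _)).trans ?_
      refine Asymptotics.IsBigO.of_bound 1 (Eventually.of_forall fun t => ?_)
      simp [Prod.norm_def]

open Asymptotics in
/-- First-order expansion of a strictly differentiable map along a perturbation of order `K` in the
first variable. -/
theorem isLittleO_sub_of_hasStrictFDerivAt {E F : Type*} [NormedAddCommGroup E] [NormedSpace ℂ E]
    [NormedAddCommGroup F] [NormedSpace ℂ F] {Ψ : E × ℂ → F} {Ψ' : E × ℂ →L[ℂ] F}
    (hΨ : HasStrictFDerivAt Ψ Ψ' 0) {D : ℂ → E} {d : E} (hD : Tendsto D (𝓝 0) (𝓝 d)) {K : ℕ}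
    (hK : K ≠ 0) :
    (fun t : ℂ => Ψ (t ^ K • D t, t) - Ψ (0, t) - t ^ K • Ψ' (d, 0)) =o[𝓝 0]
      fun t : ℂ => t ^ K := by
  have hpow : Tendsto (fun t : ℂ => t ^ K) (𝓝 0) (𝓝 0) := by
    simpa [zero_pow hK] using (continuous_pow (M := ℂ) K).tendsto 0
  have h1 : Tendsto (fun t : ℂ => ((t ^ K • D t, t), ((0 : E), t))) (𝓝 0)
      (𝓝 ((0 : E × ℂ), (0 : E × ℂ))) := by
    refine Tendsto.prodMk_nhds (Tendsto.prodMk_nhds ?_ tendsto_id)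
      (Tendsto.prodMk_nhds tendsto_const_nhds tendsto_id)
    simpa using hpow.smul hD
  have h2 := hΨ.isLittleO.comp_tendsto h1
  have hDO : (fun t : ℂ => t ^ K • D t) =O[𝓝 0] fun t : ℂ => t ^ K := by
    simpa using (isBigO_refl (fun t : ℂ => t ^ K) (𝓝 0)).smul (hD.isBigO_one ℂ)
  have h3 : (fun t : ℂ => Ψ (t ^ K • D t, t) - Ψ (0, t) - Ψ' (t ^ K • D t, 0)) =o[𝓝 0]
      fun t : ℂ => t ^ K := by
    refine IsLittleO.trans_isBigO (h2.congr_left fun t => ?_) (IsBigO.trans ?_ hDO)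
    · simp [-map_sub]
    · refine IsBigO.of_bound 1 (Eventually.of_forall fun t => ?_)
      simp [Prod.norm_def]
  have h4 : (fun t : ℂ => t ^ K • Ψ' (D t - d, 0)) =o[𝓝 0] fun t : ℂ => t ^ K := by
    have h5 : Tendsto (fun t => Ψ' (D t - d, 0)) (𝓝 0) (𝓝 0) := by
      have h6 : Tendsto (fun t => (D t - d, (0 : ℂ))) (𝓝 0) (𝓝 (0 : E × ℂ)) := by
        refine Tendsto.prodMk_nhds ?_ tendsto_const_nhds
        simpa using hD.sub_const d
      simpa [Function.comp_def] using (Ψ'.continuous.tendsto 0).comp h6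
    simpa using (isBigO_refl (fun t : ℂ => t ^ K) (𝓝 0)).smul_isLittleO
      ((isLittleO_one_iff ℂ).2 h5)
  refine (h3.add h4).congr_left fun t => ?_
  have h7 : Ψ' (t ^ K • D t, 0) = t ^ K • Ψ' (D t, 0) := by
    rw [← map_smul]
    simp
  have h8 : Ψ' (D t - d, 0) = Ψ' (D t, 0) - Ψ' (d, 0) := by
    rw [← map_sub]
    simp
  rw [h7, h8, smul_sub]
  abel

/-! ### The curve near a limit point -/

theorem evalPoly_eq_sum_character (c : Tuple A) (i : Fin (n + 1)) (z : Point n) :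
    evalPoly c i z = ∑ α : A, c i α * character z α * z.2.2 ^ α.1.2.2 :=
  Finset.sum_congr rfl fun _ _ => (mul_assoc _ _ _).symm

theorem evalPoly_eq_slice_zero (c : Tuple A) (i : Fin (n + 1)) {z : Point n} (hz : z.2.2 = 0) :
    evalPoly c i z = slice c i 0 z := by
  rw [evalPoly_eq_sum_character, slice, Finset.sum_filter]
  refine Finset.sum_congr rfl fun α _ => ?_
  rw [hz, zero_zpow_eq, Nat.cast_zero]
  split_ifs <;> simp [character]

theorem analyticAt_character (α : Exponent n) {z : Point n} (hx : ∀ j, z.1 j ≠ 0)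
    (hy : z.2.1 ≠ 0) : AnalyticAt ℂ (fun z : Point n => character z α) z := by
  unfold character
  refine AnalyticAt.mul (Finset.analyticAt_fun_prod _ fun j _ => AnalyticAt.zpow ?_ (hx j))
    (AnalyticAt.zpow ?_ hy)
  · exact ((ContinuousLinearMap.proj (R := ℂ) (φ := fun _ : Fin n => ℂ) j).comp
      (ContinuousLinearMap.fst ℂ (Fin n → ℂ) (ℂ × ℂ))).analyticAt z
  · exact ((ContinuousLinearMap.fst ℂ ℂ ℂ).comp
      (ContinuousLinearMap.snd ℂ (Fin n → ℂ) (ℂ × ℂ))).analyticAt z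

theorem analyticAt_height (z : Point n) : AnalyticAt ℂ (fun z : Point n => z.2.2) z :=
  ((ContinuousLinearMap.snd ℂ ℂ ℂ).comp
    (ContinuousLinearMap.snd ℂ (Fin n → ℂ) (ℂ × ℂ))).analyticAt z

theorem analyticAt_evalPoly (hA : ∀ α ∈ A, 0 ≤ α.2.2) (c : Tuple A) (i : Fin (n + 1))
    {z : Point n} (hx : ∀ j, z.1 j ≠ 0) (hy : z.2.1 ≠ 0) : AnalyticAt ℂ (evalPoly c i) z := by
  rw [funext (evalPoly_eq_sum_character c i)]
  refine Finset.analyticAt_fun_sum _ fun α _ => ?_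
  exact (analyticAt_const.mul (analyticAt_character _ hx hy)).mul
    ((analyticAt_height z).zpow_nonneg (hA α α.2))

theorem isFacetZero_of_mem_limitPoints (hA : ∀ α ∈ A, 0 ≤ α.2.2) {c : Tuple A} {p : Point n}
    (hp : p ∈ limitPoints c) : IsFacetZero c p := by
  obtain ⟨hx, hy, ht, hcl⟩ := hp
  refine ⟨hx, hy, fun i => ?_⟩
  rw [← evalPoly_eq_slice_zero c i ht]
  have := mem_closure_iff_nhdsWithin_neBot.1 hcl
  have h1 : Tendsto (evalPoly c i) (𝓝[curve c] p) (𝓝 (evalPoly c i p)) :=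
    (analyticAt_evalPoly hA c i hx hy).continuousAt.tendsto.mono_left nhdsWithin_le_nhds
  refine tendsto_nhds_unique h1 (tendsto_const_nhds.congr' ?_)
  filter_upwards [self_mem_nhdsWithin] with z hz
  exact (hz.2.2.2 i).symm

theorem hasDerivAt_prod_of_logarithmic {ι : Type} {f : ι → ℂ → ℂ} {a : ι → ℂ} {x : ℂ}
    (s : Finset ι) (h : ∀ j ∈ s, HasDerivAt (f j) (f j x * a j) x) :
    HasDerivAt (fun t => ∏ j ∈ s, f j t) ((∏ j ∈ s, f j x) * ∑ j ∈ s, a j) x := by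
  classical
  induction s using Finset.induction_on with
  | empty => simpa using hasDerivAt_const x (1 : ℂ)
  | insert j s hj ih =>
    have h1 := (h j (Finset.mem_insert_self j s)).fun_mul
      (ih fun k hk => h k (Finset.mem_insert_of_mem hk))
    simp only [Finset.prod_insert hj, Finset.sum_insert hj]
    refine h1.congr_deriv ?_
    ring

theorem hasDerivAt_add_mul_zpow {a : ℂ} (ha : a ≠ 0) (b : ℂ) (m : ℤ) :
    HasDerivAt (fun s : ℂ => (a + s * b) ^ m) ((a + 0 * b) ^ m * (b / a * m)) 0 := by
  have h1 : HasDerivAt (fun s : ℂ => a + s * b) b 0 := by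
    simpa using ((hasDerivAt_id' (0 : ℂ)).mul_const b).const_add a
  have h2 := (hasDerivAt_zpow m (a + 0 * b) (Or.inl (by simpa using ha))).comp (0 : ℂ) h1
  refine h2.congr_deriv ?_
  rw [zero_mul, add_zero, zpow_sub_one₀ ha]
  field_simp

theorem hasDerivAt_character_add_smul {z : Point n} (hx : ∀ j, z.1 j ≠ 0) (hy : z.2.1 ≠ 0)
    (v : Point n) (α : Exponent n) :
    HasDerivAt (fun s : ℂ => character (z + s • v) α)
      (character z α * (∑ j, v.1 j / z.1 j * (α.1 j : ℂ) + v.2.1 / z.2.1 * (α.2.1 : ℂ))) 0 := by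
  have h1 := hasDerivAt_prod_of_logarithmic Finset.univ fun j _ =>
    hasDerivAt_add_mul_zpow (hx j) (v.1 j) (α.1 j)
  have h2 := h1.fun_mul (hasDerivAt_add_mul_zpow hy v.2.1 α.2.1)
  refine h2.congr_deriv ?_
  simp only [zero_mul, add_zero, character]
  ring

/-- The derivative of `fᵢ` at a point of the orbit `t = 0` in a direction tangent to the orbit. -/
theorem fderiv_evalPoly_apply (hA : ∀ α ∈ A, 0 ≤ α.2.2) (c : Tuple A) (i : Fin (n + 1))
    {z v : Point n} (hx : ∀ j, z.1 j ≠ 0) (hy : z.2.1 ≠ 0) (hz : z.2.2 = 0) (hv : v.2.2 = 0) :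
    fderiv ℂ (evalPoly c i) z v = ∑ α : A with α.1.2.2 = 0, c i α * character z α *
      (∑ j, v.1 j / z.1 j * (α.1.1 j : ℂ) + v.2.1 / z.2.1 * (α.1.2.1 : ℂ)) := by
  have h1 : HasDerivAt (fun s : ℂ => z + s • v) v 0 := by
    simpa using ((hasDerivAt_id' (0 : ℂ)).smul_const v).const_add z
  have h2 : HasDerivAt (fun s : ℂ => evalPoly c i (z + s • v)) (fderiv ℂ (evalPoly c i) z v) 0 := by
    have h3 := (analyticAt_evalPoly hA c i hx hy).differentiableAt.hasFDerivAt
    have h4 : z = z + (0 : ℂ) • v := by simp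
    rw [h4] at h3
    have h5 := h3.comp_hasDerivAt (0 : ℂ) h1
    rw [← h4] at h5
    exact h5
  have h3 : ∀ s : ℂ, evalPoly c i (z + s • v) =
      ∑ α : A with α.1.2.2 = 0, c i α * character (z + s • v) α := by
    intro s
    rw [evalPoly_eq_slice_zero c i (by simp [hz, hv])]
    rfl
  rw [funext h3] at h2
  refine h2.unique ?_
  refine HasDerivAt.fun_sum fun α _ => ?_
  rw [mul_assoc]
  exact (hasDerivAt_character_add_smul hx hy v α).const_mul _

/-- The map with components `f₁, …, fₙ₊₁, t`; the curve is the preimage of the axis `{0} × ℂ`. -/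
def equations (c : Tuple A) (z : Point n) : (Fin (n + 1) → ℂ) × ℂ :=
  (fun i => evalPoly c i z, z.2.2)

theorem analyticAt_equations (hA : ∀ α ∈ A, 0 ≤ α.2.2) (c : Tuple A) {z : Point n}
    (hx : ∀ j, z.1 j ≠ 0) (hy : z.2.1 ≠ 0) : AnalyticAt ℂ (equations c) z :=
  (AnalyticAt.pi fun i => analyticAt_evalPoly hA c i hx hy).prod (analyticAt_height z)

theorem fderiv_equations_apply (hA : ∀ α ∈ A, 0 ≤ α.2.2) (c : Tuple A) {z : Point n}
    (hx : ∀ j, z.1 j ≠ 0) (hy : z.2.1 ≠ 0) (v : Point n) :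
    fderiv ℂ (equations c) z v = (fun i => fderiv ℂ (evalPoly c i) z v, v.2.2) := by
  have h1 : HasFDerivAt (fun z => fun i => evalPoly c i z)
      (ContinuousLinearMap.pi fun i => fderiv ℂ (evalPoly c i) z) z :=
    hasFDerivAt_pi.2 fun i => (analyticAt_evalPoly hA c i hx hy).differentiableAt.hasFDerivAt
  have h2 : HasFDerivAt (fun z : Point n => z.2.2) ((ContinuousLinearMap.snd ℂ ℂ ℂ).comp
    (ContinuousLinearMap.snd ℂ (Fin n → ℂ) (ℂ × ℂ))) z :=
    ((ContinuousLinearMap.snd ℂ ℂ ℂ).comp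
      (ContinuousLinearMap.snd ℂ (Fin n → ℂ) (ℂ × ℂ))).hasFDerivAt
  have h3 : HasFDerivAt (equations c) _ z := h1.prodMk h2
  rw [h3.fderiv]
  rfl

/-- `Ψ` is a holomorphic local inverse at `p` of the map with components `f₁, …, fₙ₊₁, t`, with
derivative `Ψ'` at the origin. -/
structure IsLocalInverse (c : Tuple A) (p : Point n) (Ψ : (Fin (n + 1) → ℂ) × ℂ → Point n)
    (Ψ' : (Fin (n + 1) → ℂ) × ℂ →L[ℂ] Point n) : Prop where
  analyticAt : AnalyticAt ℂ Ψ 0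
  hasStrictFDerivAt : HasStrictFDerivAt Ψ Ψ' 0
  apply_zero : Ψ 0 = p
  left_inv : ∀ᶠ z in 𝓝 p, Ψ (equations c z) = z
  right_inv : ∀ᶠ w in 𝓝 0, equations c (Ψ w) = w
  fderiv_apply : ∀ w, fderiv ℂ (equations c) p (Ψ' w) = w

/-- Near a nondegenerate zero of the facet truncations, the functions `f₁, …, fₙ₊₁, t` are local
coordinates. -/
theorem exists_local_inverse (hA : ∀ α ∈ A, 0 ≤ α.2.2) {c : Tuple A}
    (hc : HasNondegenerateZeros c) {p : Point n} (hp : IsFacetZero c p) (hpt : p.2.2 = 0) :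
    ∃ Ψ Ψ', IsLocalInverse c p Ψ Ψ' := by
  have hx := hp.fst_ne_zero
  have hy := hp.snd_ne_zero
  have han := analyticAt_equations hA c hx hy
  have hp0 : equations c p = 0 := by
    refine Prod.ext (funext fun i => ?_) hpt
    exact (evalPoly_eq_slice_zero c i hpt).trans (hp.slice_eq_zero i)
  have hinj : Function.Injective (fderiv ℂ (equations c) p).toLinearMap := by
    refine (injective_iff_map_eq_zero _).2 fun v hv => ?_
    have hv' : fderiv ℂ (equations c) p v = 0 := hv
    rw [fderiv_equations_apply hA c hx hy, Prod.mk_eq_zero] at hv'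
    obtain ⟨h1, h2⟩ := hv'
    have h3 := hc p hp (fun j => v.1 j / p.1 j) (v.2.1 / p.2.1) fun i => by
      rw [← fderiv_evalPoly_apply hA c i hx hy hpt h2]
      exact congrFun h1 i
    refine Prod.ext (funext fun j => ?_) (Prod.ext ?_ h2)
    · exact (div_eq_zero_iff.1 (congrFun h3.1 j)).resolve_right (hx j)
    · exact (div_eq_zero_iff.1 h3.2).resolve_right hy
  let L : Point n ≃L[ℂ] (Fin (n + 1) → ℂ) × ℂ :=
    (LinearEquiv.ofInjectiveOfFinrankEq _ hinj (by simp)).toContinuousLinearEquiv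
  have hL : (L : Point n →L[ℂ] _) = fderiv ℂ (equations c) p := rfl
  have hstrict : HasStrictFDerivAt (equations c) (L : Point n →L[ℂ] _) p := by
    rw [hL]
    exact han.hasStrictFDerivAt
  refine ⟨hstrict.localInverse _ _ _, L.symm, ?_, ?_, ?_, hstrict.eventually_left_inverse, ?_, ?_⟩
  · rw [← hp0]
    exact (hstrict.toOpenPartialHomeomorph _).analyticAt_symm'
      hstrict.mem_toOpenPartialHomeomorph_source han hL.symm
  · rw [← hp0]
    exact hstrict.to_localInverse
  · rw [← hp0]
    exact hstrict.localInverse_apply_image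
  · rw [← hp0]
    exact hstrict.eventually_right_inverse
  · intro w
    rw [← hL]
    exact L.apply_symm_apply w

/-! ### Branches at the limit points -/

namespace IsLocalInverse

variable {c : Tuple A} {p : Point n} {Ψ : (Fin (n + 1) → ℂ) × ℂ → Point n}
  {Ψ' : (Fin (n + 1) → ℂ) × ℂ →L[ℂ] Point n}

theorem analyticAt_axis (h : IsLocalInverse c p Ψ Ψ') : AnalyticAt ℂ (fun t => Ψ (0, t)) 0 :=
  AnalyticAt.fun_comp (g := Ψ) h.analyticAt (analyticAt_const.prod analyticAt_id)

theorem equations_axis (h : IsLocalInverse c p Ψ Ψ') :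
    ∀ᶠ t in 𝓝 (0 : ℂ), equations c (Ψ (0, t)) = (0, t) := by
  have : Tendsto (fun t : ℂ => ((0 : Fin (n + 1) → ℂ), t)) (𝓝 0) (𝓝 0) :=
    tendsto_const_nhds.prodMk_nhds tendsto_id
  exact this.eventually h.right_inv

theorem tendsto_axis (h : IsLocalInverse c p Ψ Ψ') :
    Tendsto (fun t => Ψ (0, t)) (𝓝 0) (𝓝 p) := by
  have := h.analyticAt_axis.continuousAt.tendsto
  rwa [show Ψ (0, 0) = p from h.apply_zero] at this

/-- The preimage of the axis `{0} × ℂ` is a branch of the curve. -/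
theorem isBranchAt (h : IsLocalInverse c p Ψ Ψ') (hx : ∀ j, p.1 j ≠ 0) (hy : p.2.1 ≠ 0) :
    IsBranchAt c p fun t => Ψ (0, t) := by
  refine ⟨⟨h.analyticAt_axis, h.apply_zero, _, h.equations_axis, fun s hs t ht hst => ?_⟩, ?_⟩
  · have h1 : equations c (Ψ (0, s)) = (0, s) := hs
    have h2 : equations c (Ψ (0, t)) = (0, t) := ht
    have h3 : Ψ (0, s) = Ψ (0, t) := hst
    rw [h3, h2] at h1
    exact (congrArg Prod.snd h1).symm
  · have hx' : ∀ᶠ z : Point n in 𝓝 p, ∀ j, z.1 j ≠ 0 := by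
      refine eventually_all.2 fun j => ?_
      have : ContinuousAt (fun z : Point n => z.1 j) p := by fun_prop
      exact this.eventually_ne (hx j)
    have hy' : ∀ᶠ z : Point n in 𝓝 p, z.2.1 ≠ 0 := by
      have : ContinuousAt (fun z : Point n => z.2.1) p := by fun_prop
      exact this.eventually_ne hy
    filter_upwards [nhdsWithin_le_nhds h.equations_axis,
      nhdsWithin_le_nhds (h.tendsto_axis.eventually hx'),
      nhdsWithin_le_nhds (h.tendsto_axis.eventually hy'), self_mem_nhdsWithin] with t h1 h2 h3 h4
    refine ⟨h2, h3, ?_, fun i => congrFun (congrArg Prod.fst h1) i⟩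
    have : (Ψ (0, t)).2.2 = t := congrArg Prod.snd h1
    rw [this]
    exact h4

/-- Every branch is a reparametrization of the preimage of the axis by its last coordinate. -/
theorem eventually_eq_of_isBranchAt (h : IsLocalInverse c p Ψ Ψ') {γ : ℂ → Point n}
    (hγ : IsBranchAt c p γ) : ∀ᶠ s in 𝓝 0, γ s = Ψ (0, (γ s).2.2) := by
  obtain ⟨⟨han, h0, -⟩, hcurve⟩ := hγ
  have hp : equations c p = 0 := by
    have := h.right_inv.self_of_nhds
    rwa [h.apply_zero] at this
  have h1 : ∀ᶠ s in 𝓝 (0 : ℂ), equations c (γ s) = (0, (γ s).2.2) := by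
    rw [eventually_nhdsWithin_iff] at hcurve
    filter_upwards [hcurve] with s hs
    by_cases hs0 : s = 0
    · rw [hs0, h0]
      exact Prod.ext (show (equations c p).1 = 0 from congrArg Prod.fst hp) rfl
    · exact Prod.ext (funext fun i => (hs hs0).2.2.2 i) rfl
  have h2 : Tendsto γ (𝓝 0) (𝓝 p) := by
    have := han.continuousAt.tendsto
    rwa [h0] at this
  filter_upwards [h1, h2.eventually h.left_inv] with s hs hs'
  rw [← hs, hs']

theorem height_isPrimitiveArc (h : IsLocalInverse c p Ψ Ψ') {γ : ℂ → Point n}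
    (hγ : IsBranchAt c p γ) : IsPrimitiveArc (fun s => (γ s).2.2) 0 := by
  have heq := h.eventually_eq_of_isBranchAt hγ
  obtain ⟨⟨han, h0, U, hU, hinj⟩, -⟩ := hγ
  refine ⟨AnalyticAt.fun_comp (g := fun z : Point n => z.2.2) (analyticAt_height _) han, ?_,
    _, inter_mem hU heq, fun s hs t ht hst => hinj hs.1 ht.1 ?_⟩
  · have h1 := h.right_inv.self_of_nhds
    rw [h.apply_zero] at h1
    show (γ 0).2.2 = 0
    rw [h0]
    exact congrArg Prod.snd h1
  · have h1 : γ s = Ψ (0, (γ s).2.2) := hs.2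
    have h2 : γ t = Ψ (0, (γ t).2.2) := ht.2
    have h3 : (γ s).2.2 = (γ t).2.2 := hst
    rw [h1, h2, h3]

theorem proj_isPrimitiveArc (h : IsLocalInverse c p Ψ Ψ') {γ : ℂ → Point n}
    (hγ : IsBranchAt c p γ) : IsPrimitiveArc (fun s => proj (γ s)) (proj p) := by
  obtain ⟨-, -, U, hU, hinj⟩ := h.height_isPrimitiveArc hγ
  refine ⟨?_, congrArg proj hγ.1.2.1, U, hU, fun s hs t ht hst => hinj hs ht ?_⟩
  · exact AnalyticAt.fun_comp (g := fun z : Point n => z.2)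
      ((ContinuousLinearMap.snd ℂ (Fin n → ℂ) (ℂ × ℂ)).analyticAt _) hγ.1.1
  · exact congrArg Prod.snd hst

theorem analyticAt_ordinate (h : IsLocalInverse c p Ψ Ψ') :
    AnalyticAt ℂ (fun t => (Ψ (0, t)).2.1) 0 :=
  AnalyticAt.fun_comp (g := fun z : Point n => z.2.1) (((ContinuousLinearMap.fst ℂ ℂ ℂ).comp
    (ContinuousLinearMap.snd ℂ (Fin n → ℂ) (ℂ × ℂ))).analyticAt _) h.analyticAt_axis

/-- The contact order of projected branches is the order of vanishing of the difference of their
`y`-coordinates as functions of `t`. -/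
theorem contactOrder_eq {p₁ p₂ : Point n} {Ψ₁ Ψ₂ : (Fin (n + 1) → ℂ) × ℂ → Point n}
    {Ψ₁' Ψ₂' : (Fin (n + 1) → ℂ) × ℂ →L[ℂ] Point n} (h₁ : IsLocalInverse c p₁ Ψ₁ Ψ₁')
    (h₂ : IsLocalInverse c p₂ Ψ₂ Ψ₂') (hy : p₁.2.1 = p₂.2.1) {γ₁ γ₂ : ℂ → Point n}
    (hγ₁ : IsBranchAt c p₁ γ₁) (hγ₂ : IsBranchAt c p₂ γ₂) :
    contactOrder (fun s => proj (γ₁ s)) (fun s => proj (γ₂ s)) =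
      analyticOrderAt (fun t => (Ψ₂ (0, t)).2.1 - (Ψ₁ (0, t)).2.1) 0 := by
  obtain ⟨hτ₁, hτ₁0, U₁, hU₁, hinj₁⟩ := h₁.height_isPrimitiveArc hγ₁
  obtain ⟨hτ₂, hτ₂0, U₂, hU₂, hinj₂⟩ := h₂.height_isPrimitiveArc hγ₂
  refine contactOrder_eq_analyticOrderAt_sub h₁.analyticAt_ordinate h₂.analyticAt_ordinate ?_
    hτ₁ hτ₁0 (deriv_ne_zero_of_injOn hτ₁ hU₁ hinj₁) hτ₂ hτ₂0
    (deriv_ne_zero_of_injOn hτ₂ hU₂ hinj₂) ?_ ?_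
  · rw [show Ψ₁ (0, 0) = p₁ from h₁.apply_zero, show Ψ₂ (0, 0) = p₂ from h₂.apply_zero, hy]
  · filter_upwards [h₁.eventually_eq_of_isBranchAt hγ₁] with s hs
    exact Prod.ext (congrArg (fun z : Point n => z.2.1) hs) rfl
  · filter_upwards [h₂.eventually_eq_of_isBranchAt hγ₂] with s hs
    exact Prod.ext (congrArg (fun z : Point n => z.2.1) hs) rfl

end IsLocalInverse

/-! ### The order of contact -/

/-- Multiplication by `u` on the coordinates `x₁, …, xₙ`. -/
def translate (u : Fin n → ℂ) (z : Point n) : Point n := (fun j => u j * z.1 j, z.2)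

theorem character_translate (u : Fin n → ℂ) (z : Point n) (α : Exponent n) :
    character (translate u z) α = twist u α * character z α := by
  simp only [character, translate, twist, mul_zpow, Finset.prod_mul_distrib, mul_assoc]

/-- If multiplication by `u` preserves the terms of `fᵢ` of level below `K`, then it changes the
value of `fᵢ` by a multiple of `t ^ K`. -/
theorem evalPoly_translate_sub (hA : ∀ α ∈ A, 0 ≤ α.2.2) (c : Tuple A) {u : Fin n → ℂ} {K : ℕ}
    (hu : ∀ α ∈ A, α.2.2 < (K : ℤ) → twist u α = 1) (i : Fin (n + 1)) (z : Point n) :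
    evalPoly c i (translate u z) - evalPoly c i z = z.2.2 ^ K *
      ∑ α : A with (K : ℤ) ≤ α.1.2.2,
        c i α * (character (translate u z) α - character z α) * z.2.2 ^ (α.1.2.2 - K).toNat := by
  rw [evalPoly_eq_sum_character, evalPoly_eq_sum_character, ← Finset.sum_sub_distrib,
    Finset.sum_filter, Finset.mul_sum]
  refine Finset.sum_congr rfl fun α _ => ?_
  have ht : (translate u z).2.2 = z.2.2 := rfl
  rw [ht]
  split_ifs with h
  · have h1 : z.2.2 ^ α.1.2.2 = z.2.2 ^ K * z.2.2 ^ (α.1.2.2 - K).toNat := by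
      rw [← pow_add, ← zpow_natCast]
      congr 1
      have := hA α α.2
      omega
    rw [h1]
    ring
  · rw [character_translate, hu α α.2 (not_le.1 h)]
    ring

theorem tendsto_sum_level (c : Tuple A) (i : Fin (n + 1)) (K : ℕ) {g₁ g₂ : ℂ → Point n}
    {p₁ p₂ : Point n} (hx₁ : ∀ j, p₁.1 j ≠ 0) (hy₁ : p₁.2.1 ≠ 0) (hx₂ : ∀ j, p₂.1 j ≠ 0)
    (hy₂ : p₂.2.1 ≠ 0) (hg₁ : Tendsto g₁ (𝓝 0) (𝓝 p₁)) (hg₂ : Tendsto g₂ (𝓝 0) (𝓝 p₂)) :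
    Tendsto (fun t : ℂ => ∑ α : A with (K : ℤ) ≤ α.1.2.2,
      c i α * (character (g₁ t) α - character (g₂ t) α) * t ^ (α.1.2.2 - K).toNat) (𝓝 0)
      (𝓝 (slice c i K p₁ - slice c i K p₂)) := by
  have hlim : slice c i K p₁ - slice c i K p₂ = ∑ α : A with (K : ℤ) ≤ α.1.2.2,
      c i α * (character p₁ α - character p₂ α) * 0 ^ (α.1.2.2 - K).toNat := by
    rw [slice, slice, ← Finset.sum_sub_distrib, Finset.sum_filter, Finset.sum_filter]
    refine Finset.sum_congr rfl fun α _ => ?_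
    by_cases h : α.1.2.2 = (K : ℤ)
    · simp only [h, le_refl, if_true, sub_self, Int.toNat_zero, pow_zero, mul_one, mul_sub]
      rfl
    · rw [if_neg h]
      split_ifs with h'
      · rw [zero_pow (by omega), mul_zero]
      · rfl
  rw [hlim]
  refine tendsto_finsetSum _ fun α _ => ?_
  have h1 := (analyticAt_character α.1 hx₁ hy₁).continuousAt.tendsto.comp hg₁
  have h2 := (analyticAt_character α.1 hx₂ hy₂).continuousAt.tendsto.comp hg₂
  exact ((h1.sub h2).const_mul _).mul ((continuous_pow (α.1.2.2 - K).toNat).tendsto 0)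

/-- Moving the second branch to `p₁` by the element `u` of the torus changes neither its ordinate
nor the terms of the equations of level below `K`. In the local coordinates `f₁, …, fₙ₊₁, t` at `p₁`
it therefore differs from the first branch by `t ^ K` times the difference `d` of the slices of
level `K`, and its ordinate by the image of `d` under the derivative of the inverse. -/
theorem IsLocalInverse.analyticOrderAt_sub_eq (hA : ∀ α ∈ A, 0 ≤ α.2.2) {c : Tuple A}
    {p₁ p₂ : Point n} {Ψ₁ Ψ₂ : (Fin (n + 1) → ℂ) × ℂ → Point n}
    {Ψ₁' Ψ₂' : (Fin (n + 1) → ℂ) × ℂ →L[ℂ] Point n} (h₁ : IsLocalInverse c p₁ Ψ₁ Ψ₁')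
    (h₂ : IsLocalInverse c p₂ Ψ₂ Ψ₂') (hx₁ : ∀ j, p₁.1 j ≠ 0) (hy₁ : p₁.2.1 ≠ 0)
    (hx₂ : ∀ j, p₂.1 j ≠ 0) (hy₂ : p₂.2.1 ≠ 0) {u : Fin n → ℂ} (hup : translate u p₂ = p₁) {K : ℕ}
    (hK : K ≠ 0) (hu : ∀ α ∈ A, α.2.2 < (K : ℤ) → twist u α = 1)
    (hd : (Ψ₁' (fun i => slice c i K p₁ - slice c i K p₂, 0)).2.1 ≠ 0) :
    analyticOrderAt (fun t => (Ψ₂ (0, t)).2.1 - (Ψ₁ (0, t)).2.1) 0 = K := by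
  let g : ℂ → Point n := fun t => Ψ₂ (0, t)
  let D : ℂ → Fin (n + 1) → ℂ := fun t i => ∑ α : A with (K : ℤ) ≤ α.1.2.2,
    c i α * (character (translate u (g t)) α - character (g t) α) * t ^ (α.1.2.2 - K).toNat
  have hg : Tendsto g (𝓝 0) (𝓝 p₂) := h₂.tendsto_axis
  have htr : Tendsto (fun t => translate u (g t)) (𝓝 0) (𝓝 p₁) := by
    have hcont : Continuous (translate u : Point n → Point n) := by
      unfold translate
      fun_prop
    rw [← hup]
    exact (hcont.tendsto p₂).comp hg
  have hD : Tendsto D (𝓝 0) (𝓝 fun i => slice c i K p₁ - slice c i K p₂) :=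
    tendsto_pi_nhds.2 fun i => tendsto_sum_level c i K hx₁ hy₁ hx₂ hy₂ htr hg
  have heq : ∀ᶠ t in 𝓝 (0 : ℂ), translate u (g t) = Ψ₁ (t ^ K • D t, t) := by
    filter_upwards [htr.eventually h₁.left_inv, h₂.equations_axis] with t h3 h4
    have ht : (g t).2.2 = t := congrArg Prod.snd h4
    have h5 : equations c (translate u (g t)) = (t ^ K • D t, t) := by
      refine Prod.ext (funext fun i => ?_) ht
      have h6 := evalPoly_translate_sub hA c hu i (g t)
      have h7 : evalPoly c i (g t) = 0 := congrFun (congrArg Prod.fst h4) i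
      rw [h7, sub_zero, ht] at h6
      exact h6
    rw [← h5, h3]
  refine analyticOrderAt_eq_of_isLittleO (h₂.analyticAt_ordinate.sub h₁.analyticAt_ordinate) hd ?_
  have hexp := isLittleO_sub_of_hasStrictFDerivAt h₁.hasStrictFDerivAt hD hK
  have hexp' : (fun t : ℂ => (Ψ₁ (t ^ K • D t, t) - Ψ₁ (0, t) -
      t ^ K • Ψ₁' (fun i => slice c i K p₁ - slice c i K p₂, 0)).2.1) =o[𝓝 0]
      fun t : ℂ => t ^ K := by
    refine Asymptotics.IsBigO.trans_isLittleO (Asymptotics.IsBigO.of_bound 1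
      (Eventually.of_forall fun t => ?_)) hexp
    rw [one_mul]
    exact (norm_fst_le _).trans (norm_snd_le _)
  refine hexp'.congr' ?_ (EventuallyEq.refl _ _)
  filter_upwards [heq] with t ht
  rw [← ht]
  rfl

theorem twist_div_mul_character {z w : Point n} (hz : ∀ j, z.1 j ≠ 0) (hy : z.2.1 = w.2.1)
    (α : Exponent n) : twist (fun j => w.1 j / z.1 j) α * character z α = character w α := by
  rw [← character_translate]
  simp [character, translate, hy, hz]

theorem slice_sub_slice (c : Tuple A) {z w : Point n} (hz : ∀ j, z.1 j ≠ 0) (hy : z.2.1 = w.2.1)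
    (i : Fin (n + 1)) (m : ℕ) : slice c i m z - slice c i m w =
      ∑ α : A with α.1.2.2 = (m : ℤ),
        c i α * character z α * (1 - twist (fun j => w.1 j / z.1 j) α) := by
  rw [slice, slice, ← Finset.sum_sub_distrib]
  refine Finset.sum_congr rfl fun α _ => ?_
  have h := twist_div_mul_character hz hy α.1
  calc _ = c i α * character z α - c i α * character w α := rfl
    _ = _ := by rw [← h]; ring

/-- The difference of the slices of level `K` moves the ordinate to first order. -/
theorem IsLocalInverse.ordinate_ne_zero (hA : ∀ α ∈ A, 0 ≤ α.2.2) {c : Tuple A} {p₁ p₂ : Point n}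
    {Ψ : (Fin (n + 1) → ℂ) × ℂ → Point n} {Ψ' : (Fin (n + 1) → ℂ) × ℂ →L[ℂ] Point n}
    (h : IsLocalInverse c p₁ Ψ Ψ') (hp₁ : IsFacetZero c p₁) (ht : p₁.2.2 = 0)
    (hy : p₁.2.1 = p₂.2.1) {K : ℕ}
    (htr : IsTransverseAt (fun j => p₂.1 j / p₁.1 j) K c) :
    (Ψ' (fun i => slice c i K p₁ - slice c i K p₂, 0)).2.1 ≠ 0 := by
  intro h0
  set v := Ψ' (fun i => slice c i K p₁ - slice c i K p₂, 0) with hv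
  have h1 := h.fderiv_apply (fun i => slice c i K p₁ - slice c i K p₂, 0)
  rw [← hv, fderiv_equations_apply hA c hp₁.fst_ne_zero hp₁.snd_ne_zero, Prod.mk.injEq] at h1
  obtain ⟨h2, h3⟩ := h1
  have h4 := htr.transverse p₁ hp₁ (fun j => v.1 j / p₁.1 j) (-1) fun i => by
    have h5 := congrFun h2 i
    rw [fderiv_evalPoly_apply hA c i hp₁.fst_ne_zero hp₁.snd_ne_zero ht h3] at h5
    simp only [h0, zero_div, zero_mul, add_zero] at h5
    rw [h5, slice_sub_slice c hp₁.fst_ne_zero hy]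
    ring
  simp at h4

/-- The level `K` is the lowest one carrying an exponent that distinguishes the `x`-coordinates of
`p₁` and `p₂`. -/
theorem IsNondegenerate.exists_separationLevel (hind : verticalIndex A = 1)
    (hfacet : HasVerticalFacet A) {c : Tuple A} (hc : IsNondegenerate c) {p₁ p₂ : Point n}
    (hp₁ : p₁ ∈ limitPoints c) (hp₂ : p₂ ∈ limitPoints c) (hne : p₁ ≠ p₂)
    (hproj : proj p₁ = proj p₂) :
    ∃ K : ℕ, 1 ≤ K ∧ IsSeparationLevel c p₁ p₂ K ∧
      (∃ γ₁, IsBranchAt c p₁ γ₁) ∧ (∃ γ₂, IsBranchAt c p₂ γ₂) ∧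
      ∀ γ₁ γ₂ : ℂ → Point n, IsBranchAt c p₁ γ₁ → IsBranchAt c p₂ γ₂ →
        IsPrimitiveArc (fun s => proj (γ₁ s)) (proj p₁) ∧
        IsPrimitiveArc (fun s => proj (γ₂ s)) (proj p₁) ∧
        contactOrder (fun s => proj (γ₁ s)) (fun s => proj (γ₂ s)) = (K : ℕ∞) := by
  classical
  have hA : ∀ α ∈ A, 0 ≤ α.2.2 := fun α hα => nonneg_of_hasVerticalFacet hfacet hα
  have hz₁ := isFacetZero_of_mem_limitPoints hA hp₁
  have hz₂ := isFacetZero_of_mem_limitPoints hA hp₂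
  have hx₁ := hz₁.fst_ne_zero
  have hx₂ := hz₂.fst_ne_zero
  have hy : p₁.2.1 = p₂.2.1 := congrArg Prod.fst hproj
  let u : Fin n → ℂ := fun j => p₂.1 j / p₁.1 j
  have hu0 : ∀ j, u j ≠ 0 := fun j => div_ne_zero (hx₂ j) (hx₁ j)
  have hu1 : u ≠ 1 := by
    intro h
    refine hne (Prod.ext (funext fun j => ?_) hproj)
    have h1 : p₂.1 j / p₁.1 j = 1 := congrFun h j
    rw [div_eq_one_iff_eq (hx₁ j)] at h1
    exact h1.symm
  have hex : ∃ K : ℕ, ∃ α ∈ A, α.2.2 = (K : ℤ) ∧ twist u α ≠ 1 := by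
    by_contra! h
    refine hu1 (eq_one_of_forall_prod_zpow_eq_one hind u hu0 fun α hα => ?_)
    exact h α.2.2.toNat α hα (Int.toNat_of_nonneg (hA α hα)).symm
  -- the first level at which an exponent distinguishes the two points
  let K := Nat.find hex
  obtain ⟨β, hβ, hβK, hβu⟩ := Nat.find_spec hex
  have hlow : ∀ α ∈ A, α.2.2 < (K : ℤ) → twist u α = 1 := by
    intro α hα hlt
    by_contra h
    have h0 := hA α hα
    exact Nat.find_min hex (m := α.2.2.toNat) (by omega) ⟨α, hα, by omega, h⟩
  have hfac : ∀ α ∈ A, α.2.2 = 0 → twist u α = 1 := hc.collision p₁ p₂ hz₁ hz₂ hy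
  have hK : K ≠ 0 := by
    intro h0
    refine hβu (hfac β hβ ?_)
    rw [hβK]
    exact_mod_cast h0
  have htr : IsTransverseAt u K c := hc.transverse u hu0 hfac K hK β hβ hβK hβu
  obtain ⟨Ψ₁, Ψ₁', h₁⟩ := exists_local_inverse hA hc.zeros hz₁ hp₁.2.2.1
  obtain ⟨Ψ₂, Ψ₂', h₂⟩ := exists_local_inverse hA hc.zeros hz₂ hp₂.2.2.1
  refine ⟨K, Nat.one_le_iff_ne_zero.2 hK, ⟨fun m hm i => ?_, fun i => ?_⟩,
    ⟨_, h₁.isBranchAt hx₁ hz₁.snd_ne_zero⟩, ⟨_, h₂.isBranchAt hx₂ hz₂.snd_ne_zero⟩,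
    fun γ₁ γ₂ hγ₁ hγ₂ => ⟨h₁.proj_isPrimitiveArc hγ₁, ?_, ?_⟩⟩
  · rw [← sub_eq_zero, slice_sub_slice c hx₁ hy]
    refine Finset.sum_eq_zero fun α hα => ?_
    have h3 : α.1.2.2 = (m : ℤ) := (Finset.mem_filter.1 hα).2
    have h4 : twist (fun j => p₂.1 j / p₁.1 j) α = 1 := hlow α α.2 (by omega)
    rw [h4, sub_self, mul_zero]
  · rw [← sub_ne_zero, slice_sub_slice c hx₁ hy]
    exact htr.ne_zero p₁ hz₁ i
  · rw [hproj]
    exact h₂.proj_isPrimitiveArc hγ₂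
  · rw [h₁.contactOrder_eq h₂ hy hγ₁ hγ₂]
    -- the torus element moving `p₂` to `p₁` is inverse to `u`
    refine h₁.analyticOrderAt_sub_eq hA h₂ hx₁ hz₁.snd_ne_zero hx₂ hz₂.snd_ne_zero (u := u⁻¹) ?_
      hK (fun α hα hlt => ?_) (h₁.ordinate_ne_zero hA hz₁ hp₁.2.2.1 hy htr)
    · refine Prod.ext (funext fun j => ?_) hproj.symm
      simp only [translate, u, Pi.inv_apply, inv_div]
      exact div_mul_cancel₀ _ (hx₂ j)
    · have h3 := hlow α hα hlt
      simp only [twist] at h3 ⊢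
      simp [h3]

end PlaneProjection

end

theorem mainTheorem6 (n : ℕ) (hn : 1 ≤ n) (A : Finset (PlaneProjection.Exponent n))
    (hdim : PlaneProjection.IsFullDimensional A) (hzero : (0 : PlaneProjection.Exponent n) ∈ A)
    (hind : PlaneProjection.verticalIndex A = 1)
    (hfacet : PlaneProjection.HasVerticalFacet A) :
    PlaneProjection.Generic A fun c =>
      ∀ p₁ ∈ PlaneProjection.limitPoints c, ∀ p₂ ∈ PlaneProjection.limitPoints c,
        p₁ ≠ p₂ → PlaneProjection.proj p₁ = PlaneProjection.proj p₂ →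
        ∃ K : ℕ, 1 ≤ K ∧ PlaneProjection.IsSeparationLevel c p₁ p₂ K ∧
          (∃ γ₁, PlaneProjection.IsBranchAt c p₁ γ₁) ∧
          (∃ γ₂, PlaneProjection.IsBranchAt c p₂ γ₂) ∧
          ∀ γ₁ γ₂ : ℂ → PlaneProjection.Point n,
            PlaneProjection.IsBranchAt c p₁ γ₁ → PlaneProjection.IsBranchAt c p₂ γ₂ →
            PlaneProjection.IsPrimitiveArc (fun s => PlaneProjection.proj (γ₁ s))
              (PlaneProjection.proj p₁) ∧
            PlaneProjection.IsPrimitiveArc (fun s => PlaneProjection.proj (γ₂ s))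
              (PlaneProjection.proj p₁) ∧
            PlaneProjection.contactOrder (fun s => PlaneProjection.proj (γ₁ s))
              (fun s => PlaneProjection.proj (γ₂ s)) = (K : ℕ∞) :=
  (PlaneProjection.generic_isNondegenerate hzero hfacet).mono fun _ hc _ hp₁ _ hp₂ hne hproj =>
    hc.exists_separationLevel hind hfacet hp₁ hp₂ hne hproj
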